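/- Let $T>0$ and write $L^q_tL^r_x=L^q(0,T;L^r(\mathbb R^3))$. For $n\in\mathbb N$ let $\varepsilon_n\in C^1([0,T])$ with $\varepsilon_n>0$, and suppose $\varepsilon_n\to0$ uniformly on $[0,T]$ as $n\to\infty$. Let $(u_n,p_n)$ be a strong solution on $[0,T]\times\mathbb R^3$ of $$\partial_tu_n+(u_n\cdot\nabla)u_n+\tfrac12(\nabla\cdot u_n)u_n+\nabla p_n-\Delta u_n=0,\qquad \partial_t(\varepsilon_np_n)-\tfrac12\varepsilon_n'\,p_n+\nabla\cdot u_n=0,$$ that is, $u_n\in H^1(0,T;L^2(\mathbb R^3)^3)\cap L^2(0,T;H^2(\mathbb R^3)^3)$ and $p_n\in H^1(0,T;L^2(\mathbb R^3))\cap L^2(0,T;H^1(\mathbb R^3))$ (represented continuously from $[0,T]$ into $L^2(\mathbb R^3)$), and both equations hold almost everywhere in $(0,T)\times\mathbb R^3$. Suppose that for some $u_0\in L^2(\mathbb R^3)^3$ $$u_n(0,\cdot)\to u_0\quad\text{and}\quad \sqrt{\varepsilon_n(0)}\,p_n(0,\cdot)\to0\qquad\text{strongly in }L^2(\mathbb R^3)\text{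 as }n\to\infty.$$ Then, with bounds uniform in $n$: 1. $\sqrt{\varepsilon_n}\,p_n$ is bounded in $L^\infty_tL^2_x$; 2. if in addition $\varepsilon_n'/\varepsilon_n\to0$ uniformly on $[0,T]$, then the set $\{\varepsilon_n\,\partial_tp_n: n\in\mathbb N\}$ is relatively compact in $H^{-1}((0,T)\times\mathbb R^3)$, the dual of $H^1_0((0,T)\times\mathbb R^3)$; 3. $\nabla u_n$ is bounded in $L^2((0,T)\times\mathbb R^3)$; 4. $u_n$ is bounded in $L^\infty_tL^2_x\cap L^2_tL^6_x$; 5. $(u_n\cdot\nabla)u_n$ is bounded in $L^2_tL^1_x\cap L^1_tL^{3/2}_x$; 6. $(\nabla\cdot u_n)u_n$ is bounded in $L^2_tL^1_x\cap L^1_tL^{3/2}_x$. -/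

import Mathlib

open MeasureTheory Set Filter Topology
open scoped NNReal ENNReal Distributions

/-- Physical space `ℝ³`. -/
abbrev E3 : Type := EuclideanSpace ℝ (Fin 3)

/-- The open space-time slab `(0,T) × ℝ³`. -/
def slab (T : ℝ) : TopologicalSpace.Opens (ℝ × E3) :=
  ⟨Ioo 0 T ×ˢ univ, isOpen_Ioo.prod isOpen_univ⟩

/-- Lebesgue measure on `(0,T) × ℝ³`. -/
noncomputable def slabMeasure (T : ℝ) : Measure (ℝ × E3) :=
  (volume : Measure (ℝ × E3)).restrict (slab T)

/-! ### Function spaces -/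

/-- `f'` is the weak (distributional) derivative of `f` on `ℝ³`. -/
def HasWeakFDeriv {F : Type*} [NormedAddCommGroup F] [NormedSpace ℝ F]
    (f : E3 → F) (f' : E3 → E3 →L[ℝ] F) : Prop :=
  LocallyIntegrable f ∧ LocallyIntegrable f' ∧
    ∀ (φ : 𝓓((⊤ : TopologicalSpace.Opens E3), ℝ)) (v : E3),
      ∫ x, (fderiv ℝ φ x v) • f x = - ∫ x, φ x • f' x v

/-- `f ∈ L²(0,T; H¹(ℝ³))`, with spatial weak derivative `Df`. -/
structure IsL2H1 {F : Type*} [NormedAddCommGroup F] [NormedSpace ℝ F]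
    (T : ℝ) (f : ℝ → E3 → F) (Df : ℝ → E3 → E3 →L[ℝ] F) : Prop where
  memLp : MemLp (fun z : ℝ × E3 => f z.1 z.2) 2 (slabMeasure T)
  memLp_deriv : MemLp (fun z : ℝ × E3 => Df z.1 z.2) 2 (slabMeasure T)
  hasWeakFDeriv : ∀ᵐ t ∂(volume.restrict (Ioo 0 T)), HasWeakFDeriv (f t) (Df t)

/-- `f ∈ H¹(0,T; L²(ℝ³))`, with time derivative `dtf`: the function `f` is (the continuous
representative of) an absolutely continuous function `[0,T] → L²(ℝ³)`, and its time derivative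
`dtf` is square integrable on `(0,T) × ℝ³`. -/
structure IsH1L2 {F : Type*} [NormedAddCommGroup F] [NormedSpace ℝ F]
    (T : ℝ) (f dtf : ℝ → E3 → F) : Prop where
  memLp : MemLp (fun z : ℝ × E3 => f z.1 z.2) 2 (slabMeasure T)
  memLp_deriv : MemLp (fun z : ℝ × E3 => dtf z.1 z.2) 2 (slabMeasure T)
  memLp_slice : ∀ t ∈ Icc 0 T, MemLp (f t) 2 volume
  eq_add_integral : ∀ t ∈ Icc 0 T, ∀ᵐ x, f t x = f 0 x + ∫ s in 0..t, dtf s x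

/-! ### Differential expressions, as functions of the (weak) derivatives -/

/-- The divergence `∇ · u`, for the derivative `Du` of `u` at a point. -/
noncomputable def divOf (Du : E3 →L[ℝ] E3) : ℝ :=
  ∑ i : Fin 3, Du (EuclideanSpace.single i 1) i

/-- The Laplacian `Δ u`, for the second derivative `D2u` of `u` at a point. -/
noncomputable def laplacianOf (D2u : E3 →L[ℝ] E3 →L[ℝ] E3) : E3 :=
  ∑ i : Fin 3, D2u (EuclideanSpace.single i 1) (EuclideanSpace.single i 1)

/-- The gradient vector `∇ p`, for the derivative `Dp` of the scalar `p` at a point. -/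
noncomputable def gradOf (Dp : E3 →L[ℝ] ℝ) : E3 :=
  (InnerProductSpace.toDual ℝ E3).symm Dp

/-- A strong solution on `[0,T]` (in `ℝ³`, with `ν = 1` and `f = 0`) of the variable-`ε`
artificial compression system
`∂ₜu + (u·∇)u + ½(∇·u)u + ∇p - Δu = 0`, `∂ₜ(ε(t)p) - ½ εₜ(t) p + ∇·u = 0`:
`u ∈ H¹(0,T;L²) ∩ L²(0,T;H²)` and `p ∈ H¹(0,T;L²) ∩ L²(0,T;H¹)`, so that every derivative in the
system is a square integrable function, and both equations hold almost everywhere.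
The fields `dtu, Du, D2u, dtp, Dp` record the weak derivatives, which are determined
almost everywhere by `u` and `p`. -/
structure StrongSolution (T : ℝ) (ε : ℝ → ℝ) where
  /-- velocity -/
  u : ℝ → E3 → E3
  /-- pressure -/
  p : ℝ → E3 → ℝ
  /-- `∂ₜu` -/
  dtu : ℝ → E3 → E3
  /-- `∇u` -/
  Du : ℝ → E3 → E3 →L[ℝ] E3
  /-- `∇²u` -/
  D2u : ℝ → E3 → E3 →L[ℝ] E3 →L[ℝ] E3
  /-- `∂ₜp` -/
  dtp : ℝ → E3 → ℝ
  /-- `∇p`, as a linear form -/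
  Dp : ℝ → E3 → E3 →L[ℝ] ℝ
  u_time : IsH1L2 T u dtu
  u_space : IsL2H1 T u Du
  Du_space : IsL2H1 T Du D2u
  p_time : IsH1L2 T p dtp
  p_space : IsL2H1 T p Dp
  momentum : ∀ᵐ z ∂(slabMeasure T),
    dtu z.1 z.2 + Du z.1 z.2 (u z.1 z.2) + (1 / 2 : ℝ) • (divOf (Du z.1 z.2) • u z.1 z.2)
      + gradOf (Dp z.1 z.2) - laplacianOf (D2u z.1 z.2) = 0
  /- `∂ₜ(εp) = εₜ p + ε pₜ` -/
  continuity : ∀ᵐ z ∂(slabMeasure T),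
    (derivWithin ε (Icc 0 T) z.1 * p z.1 z.2 + ε z.1 * dtp z.1 z.2)
      - 1 / 2 * derivWithin ε (Icc 0 T) z.1 * p z.1 z.2 + divOf (Du z.1 z.2) = 0

/-! ### Boundedness in mixed Lebesgue spaces -/

/-- The norm of `L^q(0,T; L^r(ℝ³))`. -/
noncomputable def mixedNorm {F : Type*} [NormedAddCommGroup F]
    (T : ℝ) (q r : ℝ≥0∞) (f : ℝ → E3 → F) : ℝ≥0∞ :=
  eLpNorm (fun t => eLpNorm (f t) r volume) q (volume.restrict (Ioo 0 T))

/-- The sequence `f n` is bounded in `L^q(0,T; L^r(ℝ³))`. -/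
def BoundedInLqLr {F : Type*} [NormedAddCommGroup F]
    (T : ℝ) (q r : ℝ≥0∞) (f : ℕ → ℝ → E3 → F) : Prop :=
  (∀ n, AEStronglyMeasurable (fun z : ℝ × E3 => f n z.1 z.2) (slabMeasure T)) ∧
    ∃ C : ℝ≥0, ∀ n, mixedNorm T q r (f n) ≤ C

/-- The sequence `f n` is bounded in `L²((0,T) × ℝ³)`. -/
def BoundedInL2 {F : Type*} [NormedAddCommGroup F]
    (T : ℝ) (f : ℕ → ℝ → E3 → F) : Prop :=
  (∀ n, AEStronglyMeasurable (fun z : ℝ × E3 => f n z.1 z.2) (slabMeasure T)) ∧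
    ∃ C : ℝ≥0, ∀ n, eLpNorm (fun z : ℝ × E3 => f n z.1 z.2) 2 (slabMeasure T) ≤ C

/-! ### The space `H⁻¹((0,T) × ℝ³)` -/

theorem TestFunction.memLp_slab {T : ℝ} (φ : 𝓓(slab T, ℝ)) :
    MemLp φ 2 (slabMeasure T) :=
  (φ.continuous.memLp_of_hasCompactSupport φ.hasCompactSupport).restrict _

theorem TestFunction.memLp_fderiv_slab {T : ℝ} (φ : 𝓓(slab T, ℝ)) :
    MemLp (fderiv ℝ φ) 2 (slabMeasure T) :=
  ((φ.contDiff.continuous_fderiv (by simp)).memLp_of_hasCompactSupport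
    (φ.hasCompactSupport.fderiv (𝕜 := ℝ))).restrict _

/-- `L² × L²`, in which `H¹((0,T) × ℝ³)` is embedded by `v ↦ (v, ∇v)`, where `∇` is the full
space-time gradient. The norm induced on `H¹` is equivalent to the usual one. -/
abbrev L2Pair (T : ℝ) : Type :=
  Lp ℝ 2 (slabMeasure T) × Lp ((ℝ × E3) →L[ℝ] ℝ) 2 (slabMeasure T)

/-- A test function `φ` with its space-time gradient. -/
noncomputable def testPair {T : ℝ} (φ : 𝓓(slab T, ℝ)) : L2Pair T :=
  (φ.memLp_slab.toLp φ, φ.memLp_fderiv_slab.toLp (fderiv ℝ φ))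

/-- `H¹₀((0,T) × ℝ³)`: the closure of the test functions in the `H¹` norm. -/
noncomputable def H10 (T : ℝ) : Submodule ℝ (L2Pair T) :=
  (Submodule.span ℝ (range (testPair (T := T)))).topologicalClosure

/-- A test function as an element of `H¹₀`. -/
noncomputable def H10.ofTest {T : ℝ} (φ : 𝓓(slab T, ℝ)) : H10 T :=
  ⟨testPair φ, Submodule.le_topologicalClosure _ (Submodule.subset_span (mem_range_self φ))⟩

/-- `H⁻¹((0,T) × ℝ³)`: the normed dual of `H¹₀((0,T) × ℝ³)`. -/
abbrev HNeg1 (T : ℝ) : Type := StrongDual ℝ (H10 T)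

/-- The element `L` of `H⁻¹` is the distribution given by the locally integrable function `f`. -/
def HNeg1.Represents {T : ℝ} (L : HNeg1 T) (f : ℝ → E3 → ℝ) : Prop :=
  LocallyIntegrableOn (fun z : ℝ × E3 => f z.1 z.2) (slab T) ∧
    ∀ φ : 𝓓(slab T, ℝ), L (H10.ofTest φ) = ∫ z, f z.1 z.2 * φ z ∂(slabMeasure T)

/-- The functions `f n` belong to `H⁻¹((0,T) × ℝ³)` and form a relatively compact set in it. -/
def RelativelyCompactInHNeg1 (T : ℝ) (f : ℕ → ℝ → E3 → ℝ) : Prop :=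
  ∃ L : ℕ → HNeg1 T, (∀ n, (L n).Represents (f n)) ∧ IsCompact (closure (range L))

/-!
The bounds come from the energy equality
`‖u(t)‖² + ε(t) ‖p(t)‖² + 2 ∫₀ᵗ ‖∇u‖² = ‖u(0)‖² + ε(0) ‖p(0)‖²` (`StrongSolution.energy_eq`),
whose right-hand side is bounded along the sequence by the convergence of the initial data. It is
obtained by testing the momentum equation with `u` and the continuity equation with `p`: the
skew-symmetrized convection term does no work, the two pressure terms cancel, and the term
`-½ ε' p` turns `ε p ∂ₜp + ε' p²` into `½ ∂ₜ(ε p²)`.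

Testing at a fixed time is integration by parts in `H¹(ℝ³)` for products of two and of three
functions (`HasWeakFDeriv.integral_mul_eq_neg`, `HasWeakFDeriv.integral_trilinear`). Both follow
from the density of smooth compactly supported functions in `H¹`
(`HasWeakFDeriv.exists_smooth_approx`: mollify, then cut off); the product of three functions needs
convergence in `L⁴`, which the Sobolev embedding `H¹ ⊆ L⁶` (`HasWeakFDeriv.eLpNorm_six_le`) and
interpolation provide. In time, an element of `H¹(0,T; L²)` is absolutely continuous along almost
every line `x = const` (`IsH1L2.ae_ae_eq_add_integral`), so the one-dimensional fundamental theorem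
of calculus and Fubini's theorem give the derivative of `k(t) ‖f(t)‖²`
(`IsH1L2.weighted_integral_sq_sub`) and the distributional product rule
(`IsH1L2.integral_mul_test`).

The energy bounds are the `L^∞ L²` and `L²` bounds; the Sobolev inequality gives `L² L⁶` for `u`,
and Hölder's inequality in space the bounds on the quadratic terms.
For the compactness, `ε ∂ₜp = ∂ₜ(ε p) - ε' p` with `ε p = √ε (√ε p)` and
`ε' p = (ε'/ε) √ε (√ε p)` both tending to zero in `L²`. Hence `ε ∂ₜp → 0` strongly in `H⁻¹`, and a
convergent sequence is relatively compact.
-/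

/-! ### Mollification in `L²(ℝ³)` -/

open scoped Convolution

theorem eLpNorm_two_sq {α ε : Type*} {m : MeasurableSpace α} {μ : Measure α} [ENorm ε]
    (f : α → ε) : eLpNorm f 2 μ ^ 2 = ∫⁻ x, ‖f x‖ₑ ^ 2 ∂μ := by
  have h := eLpNorm_nnreal_pow_eq_lintegral (f := f) (μ := μ) (p := 2) two_ne_zero
  simpa only [NNReal.coe_ofNat, ENNReal.rpow_two, ENNReal.coe_ofNat] using h

theorem eLpNorm_two_le_of_sq_le {α β ε ε' : Type*} {m : MeasurableSpace α} {m' : MeasurableSpace β}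
    {μ : Measure α} {ν : Measure β} [ENorm ε] [ENorm ε'] {f : α → ε} {g : β → ε'}
    (h : ∫⁻ x, ‖f x‖ₑ ^ 2 ∂μ ≤ ∫⁻ x, ‖g x‖ₑ ^ 2 ∂ν) : eLpNorm f 2 μ ≤ eLpNorm g 2 ν := by
  rw [← eLpNorm_two_sq, ← eLpNorm_two_sq] at h
  exact (ENNReal.pow_le_pow_left_iff two_ne_zero).1 h

section Mollification

variable {F : Type*} [NormedAddCommGroup F] [NormedSpace ℝ F]

/-- The mollification `ρ * f` of `f : ℝ³ → F` by the normalized bump function `ρ`. -/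
noncomputable def mollify (ρ : ContDiffBump (0 : E3)) (f : E3 → F) : E3 → F :=
  ρ.normed volume ⋆[ContinuousLinearMap.lsmul ℝ ℝ, volume] f

theorem mollify_apply (ρ : ContDiffBump (0 : E3)) (f : E3 → F) (x : E3) :
    mollify ρ f x = ∫ y, ρ.normed volume y • f (x - y) := rfl

theorem mollify_apply_swap (ρ : ContDiffBump (0 : E3)) (f : E3 → F) (x : E3) :
    mollify ρ f x = ∫ y, ρ.normed volume (x - y) • f y := by
  rw [mollify, convolution_eq_swap]; rfl

theorem lintegral_enorm_normed (ρ : ContDiffBump (0 : E3)) :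
    ∫⁻ y, ‖ρ.normed volume y‖ₑ = 1 := by
  have h := ofReal_integral_norm_eq_lintegral_enorm (ρ.integrable_normed (μ := volume))
  rw [← h]
  simp_rw [Real.norm_of_nonneg (ρ.nonneg_normed _), ρ.integral_normed, ENNReal.ofReal_one]

/-- Jensen's inequality for the probability density `ρ`. -/
theorem enorm_mollify_sq_le (ρ : ContDiffBump (0 : E3)) {f : E3 → F}
    (hf : AEStronglyMeasurable f volume) (x : E3) :
    ‖mollify ρ f x‖ₑ ^ 2 ≤ ∫⁻ y, ‖ρ.normed volume y‖ₑ * ‖f (x - y)‖ₑ ^ 2 := by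
  have hfx : AEMeasurable (fun y => ‖f (x - y)‖ₑ) volume :=
    (hf.comp_quasiMeasurePreserving (quasiMeasurePreserving_sub_left volume x)).enorm
  have hρ : AEMeasurable (fun y => ‖ρ.normed volume y‖ₑ) volume :=
    ρ.continuous_normed.aestronglyMeasurable.enorm
  have h1 : ‖mollify ρ f x‖ₑ ≤ ∫⁻ y, ‖ρ.normed volume y‖ₑ * ‖f (x - y)‖ₑ := by
    rw [mollify_apply]
    refine (enorm_integral_le_lintegral_enorm _).trans_eq ?_
    simp_rw [enorm_smul]
  have h2 := ENNReal.lintegral_mul_le_Lp_mul_Lq volume Real.HolderConjugate.two_two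
    (hρ.pow_const (1 / 2 : ℝ)) ((hρ.pow_const (1 / 2 : ℝ)).mul hfx)
  simp only [Pi.mul_apply, ENNReal.rpow_two, mul_pow, ← mul_assoc] at h2
  have h3 : ∀ y, (‖ρ.normed volume y‖ₑ ^ (1 / 2 : ℝ)) ^ 2 = ‖ρ.normed volume y‖ₑ := fun y => by
    rw [← ENNReal.rpow_mul_natCast]; norm_num
  simp only [h3, ← sq, lintegral_enorm_normed, ENNReal.one_rpow, one_mul] at h2
  calc ‖mollify ρ f x‖ₑ ^ 2
      ≤ ((∫⁻ y, ‖ρ.normed volume y‖ₑ * ‖f (x - y)‖ₑ ^ 2) ^ (1 / 2 : ℝ)) ^ 2 := by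
        gcongr; exact h1.trans h2
    _ = _ := by rw [← ENNReal.rpow_mul_natCast]; norm_num

theorem eLpNorm_mollify_le (ρ : ContDiffBump (0 : E3)) {f : E3 → F}
    (hf : AEStronglyMeasurable f volume) :
    eLpNorm (mollify ρ f) 2 volume ≤ eLpNorm f 2 volume := by
  refine eLpNorm_two_le_of_sq_le ?_
  have hm : AEMeasurable (fun z : E3 × E3 => ‖ρ.normed volume z.2‖ₑ * ‖f (z.1 - z.2)‖ₑ ^ 2)
      (volume.prod volume) := by
    refine AEMeasurable.mul ?_ (AEMeasurable.pow_const (β := ℝ≥0∞) ?_ 2)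
    · exact (ρ.continuous_normed.comp continuous_snd).aestronglyMeasurable.enorm
    · exact (hf.comp_quasiMeasurePreserving
        (quasiMeasurePreserving_sub volume volume)).enorm
  calc ∫⁻ x, ‖mollify ρ f x‖ₑ ^ 2
      ≤ ∫⁻ x, ∫⁻ y, ‖ρ.normed volume y‖ₑ * ‖f (x - y)‖ₑ ^ 2 :=
        lintegral_mono fun x => enorm_mollify_sq_le ρ hf x
    _ = ∫⁻ y, ∫⁻ x, ‖ρ.normed volume y‖ₑ * ‖f (x - y)‖ₑ ^ 2 :=
        lintegral_lintegral_swap hm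
    _ = ∫⁻ y, ‖ρ.normed volume y‖ₑ * ∫⁻ x, ‖f x‖ₑ ^ 2 := by
        refine lintegral_congr fun y => ?_
        rw [lintegral_const_mul' _ _ (by simp),
          lintegral_sub_right_eq_self (fun x => ‖f x‖ₑ ^ 2) y]
    _ = ∫⁻ x, ‖f x‖ₑ ^ 2 := by
        rw [lintegral_mul_const'' _ ρ.continuous_normed.aestronglyMeasurable.enorm,
          lintegral_enorm_normed, one_mul]

theorem mollify_sub (ρ : ContDiffBump (0 : E3)) {f g : E3 → F}
    (hf : LocallyIntegrable f) (hg : LocallyIntegrable g) :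
    mollify ρ (f - g) = mollify ρ f - mollify ρ g := by
  have key : ∀ h : E3 → F, LocallyIntegrable h → ∀ x,
      Integrable (fun y => ρ.normed volume y • h (x - y)) := fun h hh x =>
    ρ.hasCompactSupport_normed.convolutionExists_left (ContinuousLinearMap.lsmul ℝ ℝ)
      ρ.continuous_normed hh x
  funext x
  simp only [mollify_apply, Pi.sub_apply, smul_sub]
  exact integral_sub (key f hf x) (key g hg x)

theorem contDiff_mollify [CompleteSpace F] (ρ : ContDiffBump (0 : E3)) {f : E3 → F}
    (hf : LocallyIntegrable f) : ContDiff ℝ (⊤ : ℕ∞) (mollify ρ f) :=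
  ρ.hasCompactSupport_normed.contDiff_convolution_left (n := ⊤) (ContinuousLinearMap.lsmul ℝ ℝ)
    ρ.contDiff_normed hf

/-- A sequence of bump functions around `0` whose supports shrink to `0`. -/
noncomputable def shrinkingBump (n : ℕ) : ContDiffBump (0 : E3) :=
  ⟨1 / (n + 1) / 2, 1 / (n + 1), by positivity, half_lt_self (by positivity)⟩

theorem shrinkingBump_rOut_le (n : ℕ) : (shrinkingBump n).rOut ≤ 1 := by
  simp only [shrinkingBump]
  rw [div_le_one (by positivity)]; simp

theorem tendsto_shrinkingBump_rOut : Tendsto (fun n => (shrinkingBump n).rOut) atTop (𝓝 0) :=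
  tendsto_one_div_add_atTop_nhds_zero_nat

theorem tendsto_eLpNorm_mollify_sub_of_continuous [CompleteSpace F] {g : E3 → F} (hg : Continuous g)
    (hgc : HasCompactSupport g) :
    Tendsto (fun n => eLpNorm (mollify (shrinkingBump n) g - g) 2 volume) atTop (𝓝 0) := by
  obtain ⟨R, hR⟩ := hgc.isCompact.isBounded.subset_closedBall (0 : E3)
  have huc := hgc.uniformContinuous_of_continuous hg
  set K : Set E3 := Metric.closedBall 0 (R + 1) with hK
  -- The bump functions have radius at most `1`, so the difference is supported in `K`.
  have hzero : ∀ n, ∀ x ∉ K, (mollify (shrinkingBump n) g - g) x = 0 := by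
    intro n x hx
    have hb : ∀ y ∈ Metric.ball x (shrinkingBump n).rOut, g y = 0 := by
      intro y hy
      by_contra hne
      have hyR := hR (subset_tsupport g hne)
      have := shrinkingBump_rOut_le n
      simp only [hK, Metric.mem_closedBall, Metric.mem_ball, not_le, dist_zero_right] at *
      have h3 := norm_le_norm_add_norm_sub' x y
      rw [← dist_eq_norm, dist_comm] at h3
      linarith
    have hgx : g x = 0 := hb x (Metric.mem_ball_self (shrinkingBump n).rOut_pos)
    have := ContDiffBump.dist_normed_convolution_le (φ := shrinkingBump n) (μ := volume) (x₀ := x)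
      (ε := 0) hg.aestronglyMeasurable (fun y hy => by rw [hb y hy, hgx, dist_self])
    rw [dist_le_zero] at this
    rw [Pi.sub_apply, sub_eq_zero]
    exact this
  have hvol : volume K < ∞ := measure_closedBall_lt_top
  rw [ENNReal.tendsto_nhds_zero]
  intro η hη
  set c : ℝ≥0∞ := volume K ^ (2 : ℝ≥0∞).toReal⁻¹ with hc
  have hc' : c ≠ ∞ := ENNReal.rpow_ne_top_of_nonneg (by positivity) hvol.ne
  obtain ⟨δ, hδ, hδη⟩ : ∃ δ : ℝ, 0 < δ ∧ c * ENNReal.ofReal δ ≤ η := by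
    have ht : Tendsto (fun δ : ℝ => c * ENNReal.ofReal δ) (𝓝[>] 0) (𝓝 0) := by
      have : Tendsto (fun δ : ℝ => c * ENNReal.ofReal δ) (𝓝 0) (𝓝 (c * ENNReal.ofReal 0)) :=
        ENNReal.Tendsto.const_mul (ENNReal.tendsto_ofReal tendsto_id) (Or.inr hc')
      simpa using this.mono_left nhdsWithin_le_nhds
    obtain ⟨δ, h1, h2⟩ :=
      (((ENNReal.tendsto_nhds_zero.1 ht) η hη).and self_mem_nhdsWithin).exists
    exact ⟨δ, h2, h1⟩
  obtain ⟨r, hr, hrδ⟩ := Metric.uniformContinuous_iff.1 huc δ hδ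
  filter_upwards [tendsto_shrinkingBump_rOut.eventually (gt_mem_nhds hr)] with n hn
  have hpt : ∀ x, ‖(mollify (shrinkingBump n) g - g) x‖ ≤ δ := by
    intro x
    rw [Pi.sub_apply, ← dist_eq_norm]
    refine ContDiffBump.dist_normed_convolution_le (φ := shrinkingBump n) (μ := volume)
      hg.aestronglyMeasurable fun y hy => (hrδ ?_).le
    exact lt_trans hy hn
  calc eLpNorm (mollify (shrinkingBump n) g - g) 2 volume
      = eLpNorm (mollify (shrinkingBump n) g - g) 2 (volume.restrict K) := by
        rw [← eLpNorm_indicator_eq_eLpNorm_restrict measurableSet_closedBall]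
        congr 1
        rw [eq_comm, indicator_eq_self]
        intro x hx
        by_contra hxK
        exact hx (hzero n x hxK)
    _ ≤ (volume.restrict K) univ ^ (2 : ℝ≥0∞).toReal⁻¹ * ENNReal.ofReal δ :=
        eLpNorm_le_of_ae_bound (.of_forall hpt)
    _ ≤ η := by rwa [Measure.restrict_apply_univ]

/-- Mollifications of an `L²` function converge to it in `L²`. -/
theorem tendsto_eLpNorm_mollify_sub [CompleteSpace F] {f : E3 → F} (hf : MemLp f 2 volume) :
    Tendsto (fun n => eLpNorm (mollify (shrinkingBump n) f - f) 2 volume) atTop (𝓝 0) := by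
  rw [ENNReal.tendsto_nhds_zero]
  intro η hη
  have hη3 : η / 3 ≠ 0 := (ENNReal.div_pos hη.ne' (by simp)).ne'
  obtain ⟨g, hgc, hfg, hg, hgL⟩ := hf.exists_hasCompactSupport_eLpNorm_sub_le (by simp) hη3
  filter_upwards [ENNReal.tendsto_nhds_zero.1 (tendsto_eLpNorm_mollify_sub_of_continuous hg hgc)
    (η / 3) (pos_iff_ne_zero.2 hη3)] with n hn
  have hfl := hf.locallyIntegrable (by norm_num)
  have hgl := hgL.locallyIntegrable (by norm_num)
  set ρ := shrinkingBump n
  have hsm : ∀ {h : E3 → F}, LocallyIntegrable h → AEStronglyMeasurable (mollify ρ h) volume :=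
    fun hh => (contDiff_mollify ρ hh).continuous.aestronglyMeasurable
  have hdec : mollify ρ f - f = mollify ρ (f - g) + ((mollify ρ g - g) + (g - f)) := by
    rw [mollify_sub ρ hfl hgl]; abel
  have hfgm : AEStronglyMeasurable (f - g) volume := hf.1.sub hgL.1
  rw [hdec]
  calc _ ≤ eLpNorm (mollify ρ (f - g)) 2 volume
        + (eLpNorm (mollify ρ g - g) 2 volume + eLpNorm (g - f) 2 volume) := by
        refine (eLpNorm_add_le (hsm (hfl.sub hgl)) (((hsm hgl).sub hgL.1).add (hgL.1.sub hf.1))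
          (by norm_num)).trans ?_
        gcongr
        exact eLpNorm_add_le ((hsm hgl).sub hgL.1) (hgL.1.sub hf.1) (by norm_num)
    _ ≤ η / 3 + (η / 3 + η / 3) := by
        gcongr
        · exact (eLpNorm_mollify_le ρ hfgm).trans hfg
        · rwa [eLpNorm_sub_comm]
    _ = η := by rw [← add_assoc]; exact ENNReal.add_thirds η

/-- Mollification commutes with weak differentiation. -/
theorem HasWeakFDeriv.hasFDerivAt_mollify [CompleteSpace F] {f : E3 → F}
    {f' : E3 → E3 →L[ℝ] F} (h : HasWeakFDeriv f f') (ρ : ContDiffBump (0 : E3)) (x : E3) :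
    HasFDerivAt (mollify ρ f) (mollify ρ f' x) x := by
  have hρ1 : ContDiff ℝ 1 (ρ.normed volume) := ρ.contDiff_normed (n := 1)
  have h1 := ρ.hasCompactSupport_normed.hasFDerivAt_convolution_left (μ := volume)
    (ContinuousLinearMap.lsmul ℝ ℝ) hρ1 h.1 x
  refine h1.congr_fderiv (Eq.symm ?_)
  have hcs := (ρ.hasCompactSupport_normed (μ := volume)).fderiv (𝕜 := ℝ)
  have hcont : Continuous (fderiv ℝ (ρ.normed volume)) := hρ1.continuous_fderiv one_ne_zero
  ext v
  -- The weak derivative is tested with `y ↦ ρ(x - y)`.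
  let φ : 𝓓((⊤ : TopologicalSpace.Opens E3), ℝ) :=
    ⟨fun y => ρ.normed volume (x - y), (ρ.contDiff_normed (n := ⊤)).comp
      (contDiff_const.sub contDiff_id),
      ρ.hasCompactSupport_normed.comp_homeomorph (Homeomorph.subLeft x), by simp⟩
  have hφ : ∀ y, φ y = ρ.normed volume (x - y) := fun y => rfl
  have hφ' : ∀ y, fderiv ℝ φ y v = - fderiv ℝ (ρ.normed volume) (x - y) v := by
    intro y
    have : HasFDerivAt φ ((fderiv ℝ (ρ.normed volume) (x - y)).comp
        (0 - ContinuousLinearMap.id ℝ E3)) y :=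
      ((hρ1.differentiable one_ne_zero (x - y)).hasFDerivAt).comp y
        ((hasFDerivAt_const x y).sub (hasFDerivAt_id y))
    rw [this.fderiv]; simp
  have hw := h.2.2 φ v
  simp only [hφ', hφ, neg_smul, integral_neg, neg_inj] at hw
  rw [mollify_apply_swap, ContinuousLinearMap.integral_apply, convolution_eq_swap,
    ContinuousLinearMap.integral_apply]
  · simp only [smul_apply]
    exact hw.symm
  · have := (hcs.convolutionExists_left
      ((ContinuousLinearMap.lsmul ℝ ℝ : ℝ →L[ℝ] F →L[ℝ] F).precompL E3) hcont h.1 (x := x)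
      |>.integrable_swap)
    exact this
  · have := (ρ.hasCompactSupport_normed (μ := volume)).convolutionExists_left
      (ContinuousLinearMap.lsmul ℝ ℝ) ρ.continuous_normed h.2.1 x |>.integrable_swap
    exact this

end Mollification

/-! ### Density of smooth compactly supported functions in `H¹(ℝ³)` -/

section Density

variable {F : Type*} [NormedAddCommGroup F] [NormedSpace ℝ F]

/-- A smooth cutoff function, equal to `1` on the ball of radius `n + 1` and vanishing outside the
ball of radius `2 (n + 1)`. -/
noncomputable def cutoff (n : ℕ) (x : E3) : ℝ :=
  (⟨1, 2, one_pos, one_lt_two⟩ : ContDiffBump (0 : E3)) (((n : ℝ) + 1)⁻¹ • x)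

theorem contDiff_cutoff (n : ℕ) : ContDiff ℝ (⊤ : ℕ∞) (cutoff n) :=
  ContDiff.comp (ContDiffBump.contDiff _) (contDiff_const_smul _)

theorem hasCompactSupport_cutoff (n : ℕ) : HasCompactSupport (cutoff n) :=
  (ContDiffBump.hasCompactSupport _).comp_homeomorph
    (Homeomorph.smulOfNeZero (((n : ℝ) + 1)⁻¹) (by positivity))

theorem norm_cutoff_le (n : ℕ) (x : E3) : ‖cutoff n x‖ ≤ 1 := by
  rw [cutoff, Real.norm_of_nonneg (ContDiffBump.nonneg _)]
  exact ContDiffBump.le_one _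

theorem tendsto_cutoff (x : E3) : Tendsto (fun n => cutoff n x) atTop (𝓝 1) := by
  refine tendsto_const_nhds.congr' ?_
  filter_upwards [eventually_ge_atTop ⌈‖x‖⌉₊] with n hn
  refine (ContDiffBump.one_of_mem_closedBall _ ?_).symm
  rw [Metric.mem_closedBall, dist_zero_right, norm_smul, norm_inv,
    Real.norm_of_nonneg (by positivity), inv_mul_le_one₀ (by positivity)]
  have := Nat.ceil_le.1 hn
  linarith

theorem exists_norm_fderiv_cutoff_le :
    ∃ M : ℝ, 0 ≤ M ∧ ∀ n x, ‖fderiv ℝ (cutoff n) x‖ ≤ ((n : ℝ) + 1)⁻¹ * M := by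
  set χ : ContDiffBump (0 : E3) := ⟨1, 2, one_pos, one_lt_two⟩
  have hχ : ContDiff ℝ 1 χ := χ.contDiff
  obtain ⟨M, hM⟩ := (hχ.continuous_fderiv one_ne_zero).bounded_above_of_compact_support
    (χ.hasCompactSupport.fderiv (𝕜 := ℝ))
  refine ⟨M, (norm_nonneg _).trans (hM 0), fun n x => ?_⟩
  have h : HasFDerivAt (cutoff n) ((fderiv ℝ χ (((n : ℝ) + 1)⁻¹ • x)).comp
      (((n : ℝ) + 1)⁻¹ • ContinuousLinearMap.id ℝ E3)) x :=
    (hχ.differentiable one_ne_zero _).hasFDerivAt.comp x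
      ((hasFDerivAt_id x).const_smul (((n : ℝ) + 1)⁻¹))
  rw [h.fderiv, ContinuousLinearMap.comp_smul, ContinuousLinearMap.comp_id, norm_smul, norm_inv,
    Real.norm_of_nonneg (by positivity)]
  gcongr
  exact hM _

theorem tendsto_eLpNorm_cutoff_smul_sub {h : E3 → F} (hh : MemLp h 2 volume) :
    Tendsto (fun n => eLpNorm (fun x => cutoff n x • h x - h x) 2 volume) atTop (𝓝 0) := by
  have hsq : Tendsto (fun n => ∫⁻ x, ‖cutoff n x • h x - h x‖ₑ ^ 2) atTop
      (𝓝 (∫⁻ _ : E3, 0)) := by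
    refine tendsto_lintegral_of_dominated_convergence' (fun x => (2 * ‖h x‖ₑ) ^ 2) ?_ ?_ ?_ ?_
    · exact fun n => ((((contDiff_cutoff n).continuous.aestronglyMeasurable.smul hh.1).sub
        hh.1).enorm).pow_const 2
    · refine fun n => .of_forall fun x => ?_
      refine pow_le_pow_left' ?_ 2
      refine (enorm_sub_le).trans ?_
      rw [two_mul, enorm_smul]
      gcongr
      have : ‖cutoff n x‖ₑ ≤ 1 := by
        rw [← ofReal_norm]; simpa using norm_cutoff_le n x
      calc _ ≤ 1 * ‖h x‖ₑ := by gcongr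
        _ = _ := one_mul _
    · simp_rw [mul_pow]
      rw [lintegral_const_mul' _ _ (by simp), ← eLpNorm_two_sq]
      exact ENNReal.mul_ne_top (by simp) (ENNReal.pow_ne_top hh.2.ne)
    · refine .of_forall fun x => ?_
      have h1 : Tendsto (fun n => cutoff n x • h x - h x) atTop (𝓝 (1 • h x - h x)) := by
        have := ((tendsto_cutoff x).smul_const (h x)).sub_const (h x)
        simpa using this
      have h2 := ((ENNReal.continuous_pow 2).tendsto _).comp h1.enorm
      simpa [Function.comp_def] using h2
  simp_rw [← eLpNorm_two_sq, lintegral_zero] at hsq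
  have := (ENNReal.continuous_rpow_const (y := 1 / 2)).tendsto 0 |>.comp hsq
  refine (this.congr fun n => ?_).trans_eq (by simp)
  simp only [Function.comp_apply]
  rw [← ENNReal.rpow_natCast_mul]
  norm_num

theorem exists_smooth_approx_of_smooth {g : E3 → F} (hg : ContDiff ℝ (⊤ : ℕ∞) g)
    (hgL : MemLp g 2 volume) (hDg : MemLp (fderiv ℝ g) 2 volume) {η : ℝ≥0∞} (hη : 0 < η) :
    ∃ φ : E3 → F, ContDiff ℝ (⊤ : ℕ∞) φ ∧ HasCompactSupport φ ∧
      eLpNorm (φ - g) 2 volume ≤ η ∧ eLpNorm (fderiv ℝ φ - fderiv ℝ g) 2 volume ≤ η := by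
  obtain ⟨M, hM0, hM⟩ := exists_norm_fderiv_cutoff_le
  have hlim : Tendsto (fun n : ℕ => eLpNorm (fun x => cutoff n x • fderiv ℝ g x - fderiv ℝ g x) 2
      volume + ENNReal.ofReal (((n : ℝ) + 1)⁻¹ * M) * eLpNorm g 2 volume) atTop (𝓝 0) := by
    have h1 : Tendsto (fun n : ℕ => ENNReal.ofReal (((n : ℝ) + 1)⁻¹ * M)) atTop (𝓝 0) := by
      have := ENNReal.tendsto_ofReal (tendsto_one_div_add_atTop_nhds_zero_nat.mul_const M)
      simpa using this
    have h2 := (tendsto_eLpNorm_cutoff_smul_sub hDg).add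
      (ENNReal.Tendsto.mul_const h1 (Or.inr hgL.2.ne))
    simpa using h2
  obtain ⟨n, hn1, hn2⟩ := ((ENNReal.tendsto_nhds_zero.1 (tendsto_eLpNorm_cutoff_smul_sub hgL) η
    hη).and (ENNReal.tendsto_nhds_zero.1 hlim η hη)).exists
  refine ⟨fun x => cutoff n x • g x, (contDiff_cutoff n).smul hg,
    (hasCompactSupport_cutoff n).smul_right, hn1, le_trans ?_ hn2⟩
  have hd : ∀ x, fderiv ℝ (fun x => cutoff n x • g x) x
      = cutoff n x • fderiv ℝ g x + (fderiv ℝ (cutoff n) x).smulRight (g x) := fun x =>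
    fderiv_fun_smul ((contDiff_cutoff n).differentiable (by simp) x)
      (hg.differentiable (by simp) x)
  have hcont : Continuous fun x => (fderiv ℝ (cutoff n) x).smulRight (g x) := by
    have h1 : Continuous (fderiv ℝ (cutoff n)) :=
      (contDiff_cutoff n).continuous_fderiv (by simp)
    have h2 := hg.continuous
    exact (ContinuousLinearMap.smulRightL ℝ E3 F).isBoundedBilinearMap.continuous.comp
      (h1.prodMk h2)
  have heq : fderiv ℝ (fun x => cutoff n x • g x) - fderiv ℝ g
      = (fun x => cutoff n x • fderiv ℝ g x - fderiv ℝ g x)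
        + fun x => (fderiv ℝ (cutoff n) x).smulRight (g x) := by
    funext x
    simp only [Pi.sub_apply, Pi.add_apply, hd]
    abel
  rw [heq]
  refine (eLpNorm_add_le (((contDiff_cutoff n).continuous.aestronglyMeasurable.smul hDg.1).sub
    hDg.1) hcont.aestronglyMeasurable (by norm_num)).trans ?_
  refine add_le_add_right ?_ _
  refine eLpNorm_le_mul_eLpNorm_of_ae_le_mul (g := g) (Eventually.of_forall fun x => ?_) 2
  rw [ContinuousLinearMap.norm_smulRight_apply]
  gcongr
  exact hM n x

/-- The smooth compactly supported functions are dense in `H¹(ℝ³)`. -/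
theorem HasWeakFDeriv.exists_smooth_approx [CompleteSpace F] {f : E3 → F}
    {f' : E3 → E3 →L[ℝ] F} (h : HasWeakFDeriv f f') (hf : MemLp f 2 volume)
    (hf' : MemLp f' 2 volume) :
    ∃ φ : ℕ → E3 → F, (∀ n, ContDiff ℝ (⊤ : ℕ∞) (φ n)) ∧ (∀ n, HasCompactSupport (φ n)) ∧
      Tendsto (fun n => eLpNorm (φ n - f) 2 volume) atTop (𝓝 0) ∧
      Tendsto (fun n => eLpNorm (fderiv ℝ (φ n) - f') 2 volume) atTop (𝓝 0) := by
  have key : ∀ n, ∃ φ : E3 → F, ContDiff ℝ (⊤ : ℕ∞) φ ∧ HasCompactSupport φ ∧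
      eLpNorm (φ - mollify (shrinkingBump n) f) 2 volume ≤ (n : ℝ≥0∞)⁻¹ ∧
      eLpNorm (fderiv ℝ φ - mollify (shrinkingBump n) f') 2 volume ≤ (n : ℝ≥0∞)⁻¹ := by
    intro n
    have hD : fderiv ℝ (mollify (shrinkingBump n) f) = mollify (shrinkingBump n) f' :=
      funext fun x => (h.hasFDerivAt_mollify _ x).fderiv
    have hsm := contDiff_mollify (shrinkingBump n) h.1
    have hsm' := contDiff_mollify (shrinkingBump n) h.2.1
    rw [← hD]
    refine exists_smooth_approx_of_smooth hsm
      ⟨hsm.continuous.aestronglyMeasurable, (eLpNorm_mollify_le _ hf.1).trans_lt hf.2⟩ ?_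
      (by simp)
    rw [hD]
    exact ⟨hsm'.continuous.aestronglyMeasurable, (eLpNorm_mollify_le _ hf'.1).trans_lt hf'.2⟩
  choose φ h1 h2 h3 h4 using key
  refine ⟨φ, h1, h2, ?_, ?_⟩
  · have := ENNReal.tendsto_inv_nat_nhds_zero.add (tendsto_eLpNorm_mollify_sub hf)
    rw [add_zero] at this
    refine tendsto_of_tendsto_of_tendsto_of_le_of_le tendsto_const_nhds this
      (fun _ => zero_le) fun n => ?_
    have hm := (contDiff_mollify (shrinkingBump n) h.1).continuous.aestronglyMeasurable
      (μ := volume)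
    have hd : φ n - f
        = (φ n - mollify (shrinkingBump n) f) + (mollify (shrinkingBump n) f - f) := by
      abel
    dsimp only
    rw [hd]
    refine (eLpNorm_add_le ((h1 n).continuous.aestronglyMeasurable.sub hm) (hm.sub hf.1)
      (by norm_num)).trans ?_
    gcongr
    exact h3 n
  · have := ENNReal.tendsto_inv_nat_nhds_zero.add (tendsto_eLpNorm_mollify_sub hf')
    rw [add_zero] at this
    refine tendsto_of_tendsto_of_tendsto_of_le_of_le tendsto_const_nhds this
      (fun _ => zero_le) fun n => ?_
    have hm := (contDiff_mollify (shrinkingBump n) h.2.1).continuous.aestronglyMeasurable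
      (μ := volume)
    have hd : fderiv ℝ (φ n) - f' = (fderiv ℝ (φ n) - mollify (shrinkingBump n) f')
        + (mollify (shrinkingBump n) f' - f') := by
      abel
    dsimp only
    rw [hd]
    refine (eLpNorm_add_le (((h1 n).continuous_fderiv (by simp)).aestronglyMeasurable.sub hm)
      (hm.sub hf'.1) (by norm_num)).trans ?_
    gcongr
    exact h4 n

end Density

/-! ### Products of convergent sequences; the Sobolev inequality in `H¹(ℝ³)` -/

section Products

variable {α : Type*} {m : MeasurableSpace α} {μ : Measure α}

theorem holderTriple_four_four_two : ENNReal.HolderTriple 4 4 2 := by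
  refine ⟨?_⟩
  have h4 : (4 : ℝ≥0∞) = 2 * 2 := by norm_num
  rw [h4, ENNReal.mul_inv (by simp) (by simp), ← two_mul, ← mul_assoc,
    ENNReal.mul_inv_cancel (by simp) (by simp), one_mul]

theorem eLpNorm_le_eLpNorm_sub_add {F : Type*} [NormedAddCommGroup F] {p : ℝ≥0∞} {f g : α → F}
    (hf : AEStronglyMeasurable f μ) (hg : AEStronglyMeasurable g μ) (hp : 1 ≤ p) :
    eLpNorm f p μ ≤ eLpNorm (f - g) p μ + eLpNorm g p μ := by
  have h := eLpNorm_add_le (hf.sub hg) hg hp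
  rwa [sub_add_cancel] at h

theorem eLpNorm_mul_le_mul_eLpNorm {p q r : ℝ≥0∞} [ENNReal.HolderTriple p q r] {a b : α → ℝ}
    (ha : AEStronglyMeasurable a μ) (hb : AEStronglyMeasurable b μ) :
    eLpNorm (a * b) r μ ≤ eLpNorm a p μ * eLpNorm b q μ := by
  rw [← smul_eq_mul]
  exact eLpNorm_smul_le_mul_eLpNorm hb ha

theorem tendsto_eLpNorm_mul_sub {p q r : ℝ≥0∞} [ENNReal.HolderTriple p q r] (hr : 1 ≤ r)
    {a b : ℕ → α → ℝ} {a' b' : α → ℝ} (ha : ∀ n, AEStronglyMeasurable (a n) μ)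
    (hb : ∀ n, AEStronglyMeasurable (b n) μ) (ha' : MemLp a' p μ) (hb' : MemLp b' q μ)
    (hla : Tendsto (fun n => eLpNorm (a n - a') p μ) atTop (𝓝 0))
    (hlb : Tendsto (fun n => eLpNorm (b n - b') q μ) atTop (𝓝 0)) :
    Tendsto (fun n => eLpNorm (a n * b n - a' * b') r μ) atTop (𝓝 0) := by
  have h1 : Tendsto (fun n => eLpNorm (a n - a') p μ * eLpNorm (b n - b') q μ
      + (eLpNorm (a n - a') p μ * eLpNorm b' q μ + eLpNorm a' p μ * eLpNorm (b n - b') q μ))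
      atTop (𝓝 (0 * 0 + (0 * eLpNorm b' q μ + eLpNorm a' p μ * 0))) :=
    (ENNReal.Tendsto.mul hla (by simp) hlb (by simp)).add
      ((ENNReal.Tendsto.mul_const hla (Or.inr hb'.2.ne)).add
        (ENNReal.Tendsto.const_mul hlb (Or.inr ha'.2.ne)))
  simp only [mul_zero, zero_mul, add_zero] at h1
  refine tendsto_of_tendsto_of_tendsto_of_le_of_le tendsto_const_nhds h1 (fun _ => zero_le)
    fun n => ?_
  have hd : a n * b n - a' * b'
      = (a n - a') * (b n - b') + ((a n - a') * b' + a' * (b n - b')) := by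
    funext x
    simp only [Pi.sub_apply, Pi.mul_apply, Pi.add_apply]
    ring
  have hm := (ha n).sub ha'.1
  have hm' := (hb n).sub hb'.1
  dsimp only
  rw [hd]
  refine (eLpNorm_add_le (hm.mul hm') ((hm.mul hb'.1).add (ha'.1.mul hm')) hr).trans ?_
  refine add_le_add (eLpNorm_mul_le_mul_eLpNorm hm hm') ?_
  refine (eLpNorm_add_le (hm.mul hb'.1) (ha'.1.mul hm') hr).trans ?_
  exact add_le_add (eLpNorm_mul_le_mul_eLpNorm hm hb'.1) (eLpNorm_mul_le_mul_eLpNorm ha'.1 hm')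

theorem tendsto_integral_mul_of_L2
    {a b : ℕ → α → ℝ} {a' b' : α → ℝ} (ha : ∀ n, MemLp (a n) 2 μ)
    (hb : ∀ n, MemLp (b n) 2 μ) (ha' : MemLp a' 2 μ) (hb' : MemLp b' 2 μ)
    (hla : Tendsto (fun n => eLpNorm (a n - a') 2 μ) atTop (𝓝 0))
    (hlb : Tendsto (fun n => eLpNorm (b n - b') 2 μ) atTop (𝓝 0)) :
    Tendsto (fun n => ∫ x, a n x * b n x ∂μ) atTop (𝓝 (∫ x, a' x * b' x ∂μ)) :=
  tendsto_integral_of_L1' (a' * b') (ha'.1.mul hb'.1)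
    (.of_forall fun n => (ha n).integrable_mul (hb n))
    (tendsto_eLpNorm_mul_sub le_rfl (fun n => (ha n).1) (fun n => (hb n).1) ha' hb' hla hlb)

/-- Interpolation of `L⁴` between `L²` and `L⁶`. -/
theorem eLpNorm_four_pow_le {F : Type*} [NormedAddCommGroup F] {f : α → F}
    (hf : AEStronglyMeasurable f μ) :
    eLpNorm f 4 μ ^ 4 ≤ eLpNorm f 2 μ * eLpNorm f 6 μ ^ 3 := by
  have h := ENNReal.lintegral_mul_le_Lp_mul_Lq μ Real.HolderConjugate.two_two hf.enorm
    (hf.enorm.pow_const 3)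
  have h4 := eLpNorm_nnreal_pow_eq_lintegral (f := f) (μ := μ) (p := 4) (by norm_num)
  have h6 := eLpNorm_nnreal_pow_eq_lintegral (f := f) (μ := μ) (p := 6) (by norm_num)
  have e4 : ((4 : ℝ≥0) : ℝ) = ((4 : ℕ) : ℝ) := by norm_num
  have e6 : ((6 : ℝ≥0) : ℝ) = ((6 : ℕ) : ℝ) := by norm_num
  simp only [e4, e6, ENNReal.rpow_natCast, ENNReal.coe_ofNat] at h4 h6
  simp only [Pi.mul_apply, ENNReal.rpow_two, ← pow_succ', ← pow_mul, Nat.reduceAdd,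
    Nat.reduceMul] at h
  rw [← h4, ← h6, ← eLpNorm_two_sq] at h
  refine h.trans_eq ?_
  rw [← ENNReal.rpow_natCast_mul, ← ENNReal.rpow_natCast_mul]
  norm_num

theorem tendsto_eLpNorm_four {F : Type*} [NormedAddCommGroup F] {f : ℕ → α → F}
    (hf : ∀ n, AEStronglyMeasurable (f n) μ)
    (h2 : Tendsto (fun n => eLpNorm (f n) 2 μ) atTop (𝓝 0))
    (h6 : Tendsto (fun n => eLpNorm (f n) 6 μ) atTop (𝓝 0)) :
    Tendsto (fun n => eLpNorm (f n) 4 μ) atTop (𝓝 0) := by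
  have h : Tendsto (fun n => eLpNorm (f n) 2 μ * eLpNorm (f n) 6 μ ^ 3) atTop (𝓝 (0 * 0 ^ 3)) :=
    ENNReal.Tendsto.mul h2 (by simp) (((ENNReal.continuous_pow 3).tendsto 0).comp h6) (by simp)
  have h' := ((ENNReal.continuous_rpow_const (y := 1 / 4)).tendsto _).comp h
  refine tendsto_of_tendsto_of_tendsto_of_le_of_le tendsto_const_nhds
    (h'.trans_eq (by simp)) (fun _ => zero_le) fun n => ?_
  have := ENNReal.rpow_le_rpow (eLpNorm_four_pow_le (hf n)) (by norm_num : (0 : ℝ) ≤ 1 / 4)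
  rw [← ENNReal.rpow_natCast_mul] at this
  norm_num at this
  simpa using this

theorem MeasureTheory.MemLp.four_of_two_of_six {F : Type*} [NormedAddCommGroup F] {f : α → F}
    (h2 : MemLp f 2 μ) (h6 : MemLp f 6 μ) : MemLp f 4 μ := by
  refine ⟨h2.1, ?_⟩
  have := (eLpNorm_four_pow_le h2.1).trans_lt (ENNReal.mul_lt_top h2.2 (ENNReal.pow_lt_top h6.2))
  by_contra hn
  rw [not_lt, top_le_iff] at hn
  simp [hn] at this

end Products

section WeakDerivative

variable {F G : Type*} [NormedAddCommGroup F] [NormedSpace ℝ F]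
  [NormedAddCommGroup G] [NormedSpace ℝ G]

theorem ContinuousLinearMap.locallyIntegrable_comp (L : F →L[ℝ] G) {f : E3 → F}
    (hf : LocallyIntegrable f) : LocallyIntegrable (fun x => L (f x)) := by
  rw [← locallyIntegrableOn_univ] at hf ⊢
  exact L.locallyIntegrableOn_comp hf

theorem MeasureTheory.LocallyIntegrable.clm_apply_const {k : E3 → E3 →L[ℝ] F}
    (hk : LocallyIntegrable k) (v : E3) : LocallyIntegrable fun x => k x v :=
  (ContinuousLinearMap.apply ℝ F v).locallyIntegrable_comp hk

theorem integrable_smul_of_test {ψ : E3 → ℝ} (hψ : Continuous ψ) (hc : HasCompactSupport ψ)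
    {f : E3 → F} (hf : LocallyIntegrable f) : Integrable (fun x => ψ x • f x) :=
  hf.integrable_smul_left_of_hasCompactSupport hψ hc

theorem TestFunction.continuous_fderiv_apply {Ω : TopologicalSpace.Opens E3} (φ : 𝓓(Ω, ℝ))
    (v : E3) : Continuous fun x => fderiv ℝ φ x v :=
  (φ.contDiff.continuous_fderiv (by simp)).clm_apply continuous_const

theorem TestFunction.hasCompactSupport_fderiv_apply {Ω : TopologicalSpace.Opens E3} (φ : 𝓓(Ω, ℝ))
    (v : E3) : HasCompactSupport fun x => fderiv ℝ φ x v :=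
  φ.hasCompactSupport.fderiv_apply (𝕜 := ℝ) v

theorem HasWeakFDeriv.sub {f g : E3 → F} {f' g' : E3 → E3 →L[ℝ] F} (hf : HasWeakFDeriv f f')
    (hg : HasWeakFDeriv g g') : HasWeakFDeriv (f - g) (f' - g') := by
  refine ⟨hf.1.sub hg.1, hf.2.1.sub hg.2.1, fun φ v => ?_⟩
  have i1 := fun {k : E3 → F} (hk : LocallyIntegrable k) => integrable_smul_of_test
    (φ.continuous_fderiv_apply v) (φ.hasCompactSupport_fderiv_apply v) hk
  have i2 := fun {k : E3 → F} (hk : LocallyIntegrable k) => integrable_smul_of_test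
    φ.continuous φ.hasCompactSupport hk
  simp only [Pi.sub_apply, smul_sub, sub_apply]
  rw [integral_sub (i1 hf.1) (i1 hg.1),
    integral_sub (i2 (LocallyIntegrable.clm_apply_const hf.2.1 v))
      (i2 (LocallyIntegrable.clm_apply_const hg.2.1 v)),
    hf.2.2, hg.2.2]
  abel

theorem HasWeakFDeriv.clm_comp [CompleteSpace F] [CompleteSpace G] {f : E3 → F}
    {f' : E3 → E3 →L[ℝ] F} (hf : HasWeakFDeriv f f') (L : F →L[ℝ] G) :
    HasWeakFDeriv (fun x => L (f x)) (fun x => L.comp (f' x)) := by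
  refine ⟨L.locallyIntegrable_comp hf.1,
    (ContinuousLinearMap.compL ℝ E3 F G L).locallyIntegrable_comp hf.2.1, fun φ v => ?_⟩
  have h := congrArg L (hf.2.2 φ v)
  rw [map_neg, ← L.integral_comp_comm (integrable_smul_of_test (φ.continuous_fderiv_apply v)
    (φ.hasCompactSupport_fderiv_apply v) hf.1), ← L.integral_comp_comm (integrable_smul_of_test
    φ.continuous φ.hasCompactSupport (LocallyIntegrable.clm_apply_const hf.2.1 v))] at h
  simpa only [map_smul, ContinuousLinearMap.comp_apply] using h

theorem hasWeakFDeriv_of_contDiff [CompleteSpace F] {f : E3 → F} (hf : ContDiff ℝ 1 f) :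
    HasWeakFDeriv f (fderiv ℝ f) := by
  have hcd := hf.continuous_fderiv one_ne_zero
  have happ : ∀ v, Continuous fun x => fderiv ℝ f x v := fun v => hcd.clm_apply continuous_const
  refine ⟨hf.continuous.locallyIntegrable, hcd.locallyIntegrable, fun φ v => ?_⟩
  rw [eq_comm, neg_eq_iff_eq_neg]
  refine integral_smul_fderiv_eq_neg_fderiv_smul_of_integrable
    (integrable_smul_of_test (φ.continuous_fderiv_apply v) (φ.hasCompactSupport_fderiv_apply v)
      hf.continuous.locallyIntegrable)
    (integrable_smul_of_test φ.continuous φ.hasCompactSupport (happ v).locallyIntegrable)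
    (integrable_smul_of_test φ.continuous φ.hasCompactSupport hf.continuous.locallyIntegrable)
    (fun x _ => φ.contDiff.differentiable (by simp) x)
    (fun x _ => hf.differentiable one_ne_zero x)

end WeakDerivative

section Sobolev

variable {F : Type*} [NormedAddCommGroup F] [InnerProductSpace ℝ F]

/-- The constant in the Sobolev inequality `‖f‖_{L⁶(ℝ³)} ≤ C ‖∇f‖_{L²(ℝ³)}`. -/
noncomputable def sobolevConst : ℝ≥0 :=
  eLpNormLESNormFDerivOfEqInnerConst (volume : Measure E3) (2 : ℝ≥0)

theorem eLpNorm_six_le_of_contDiff {f : E3 → F} (hf : ContDiff ℝ 1 f) (hc : HasCompactSupport f) :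
    eLpNorm f 6 volume ≤ sobolevConst * eLpNorm (fderiv ℝ f) 2 volume := by
  have := eLpNorm_le_eLpNorm_fderiv_of_eq_inner (volume : Measure E3) hf hc (p := 2) (p' := 6)
    (by norm_num) (by simp) (by simp; norm_num)
  exact_mod_cast this

/-- The Sobolev inequality on `H¹(ℝ³)`, by density and Fatou's lemma. -/
theorem HasWeakFDeriv.eLpNorm_six_le [CompleteSpace F] {f : E3 → F} {f' : E3 → E3 →L[ℝ] F}
    (h : HasWeakFDeriv f f') (hf : MemLp f 2 volume) (hf' : MemLp f' 2 volume) :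
    eLpNorm f 6 volume ≤ sobolevConst * eLpNorm f' 2 volume := by
  obtain ⟨φ, hφ, hφc, hl, hl'⟩ := h.exists_smooth_approx hf hf'
  have hm : ∀ n, AEStronglyMeasurable (φ n) volume := fun n =>
    (hφ n).continuous.aestronglyMeasurable
  obtain ⟨ns, hns, hae⟩ :=
    (tendstoInMeasure_of_tendsto_eLpNorm two_ne_zero hm hf.1 hl).exists_seq_tendsto_ae
  refine (Lp.eLpNorm_lim_le_liminf_eLpNorm (fun n => hm (ns n)) f hae).trans ?_
  have hlim : Tendsto (fun n => sobolevConst * (eLpNorm (fderiv ℝ (φ (ns n)) - f') 2 volume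
      + eLpNorm f' 2 volume)) atTop (𝓝 (sobolevConst * (0 + eLpNorm f' 2 volume))) :=
    ENNReal.Tendsto.const_mul ((hl'.comp hns.tendsto_atTop).add_const _) (Or.inr (by simp))
  rw [zero_add] at hlim
  rw [← hlim.liminf_eq]
  refine liminf_le_liminf (.of_forall fun n => ?_)
  refine (eLpNorm_six_le_of_contDiff ((hφ _).of_le (by simp)) (hφc _)).trans ?_
  gcongr
  exact eLpNorm_le_eLpNorm_sub_add (((hφ _).continuous_fderiv (by simp)).aestronglyMeasurable)
    hf'.1 (by norm_num)

theorem HasWeakFDeriv.memLp_six [CompleteSpace F] {f : E3 → F} {f' : E3 → E3 →L[ℝ] F}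
    (h : HasWeakFDeriv f f') (hf : MemLp f 2 volume) (hf' : MemLp f' 2 volume) : MemLp f 6 volume :=
  ⟨hf.1, (h.eLpNorm_six_le hf hf').trans_lt (ENNReal.mul_lt_top (by simp) hf'.2)⟩

theorem HasWeakFDeriv.memLp_four [CompleteSpace F] {f : E3 → F} {f' : E3 → E3 →L[ℝ] F}
    (h : HasWeakFDeriv f f') (hf : MemLp f 2 volume) (hf' : MemLp f' 2 volume) : MemLp f 4 volume :=
  MemLp.four_of_two_of_six hf (h.memLp_six hf hf')

end Sobolev

/-! ### Integration by parts in `H¹(ℝ³)` -/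

section IntegrationByParts

variable {F : Type*} [NormedAddCommGroup F] [NormedSpace ℝ F]

theorem MeasureTheory.MemLp.clm_apply_const {p : ℝ≥0∞} {f' : E3 → E3 →L[ℝ] F}
    (h : MemLp f' p volume) (v : E3) :
    MemLp (fun x => f' x v) p volume :=
  (ContinuousLinearMap.apply ℝ F v).comp_memLp' h

theorem tendsto_eLpNorm_clm_apply_sub {f' : E3 → E3 →L[ℝ] F} {φ' : ℕ → E3 → E3 →L[ℝ] F}
    (h : Tendsto (fun n => eLpNorm (φ' n - f') 2 volume) atTop (𝓝 0)) (v : E3) :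
    Tendsto (fun n => eLpNorm ((fun x => φ' n x v) - fun x => f' x v) 2 volume) atTop (𝓝 0) := by
  have h1 : Tendsto (fun n => ENNReal.ofReal ‖v‖ * eLpNorm (φ' n - f') 2 volume) atTop
      (𝓝 (ENNReal.ofReal ‖v‖ * 0)) := ENNReal.Tendsto.const_mul h (by simp)
  rw [mul_zero] at h1
  refine tendsto_of_tendsto_of_tendsto_of_le_of_le tendsto_const_nhds h1 (fun _ => zero_le)
    fun n => eLpNorm_le_mul_eLpNorm_of_ae_le_mul (.of_forall fun x => ?_) 2
  rw [mul_comm]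
  exact (φ' n x - f' x).le_opNorm v

/-- Integration by parts in `H¹(ℝ³)`. -/
theorem HasWeakFDeriv.integral_mul_eq_neg {f g : E3 → ℝ} {f' g' : E3 → E3 →L[ℝ] ℝ}
    (hf : HasWeakFDeriv f f') (hg : HasWeakFDeriv g g') (hfL : MemLp f 2 volume)
    (hfL' : MemLp f' 2 volume) (hgL : MemLp g 2 volume) (hgL' : MemLp g' 2 volume) (v : E3) :
    ∫ x, f x * g' x v = - ∫ x, f' x v * g x := by
  obtain ⟨φ, hφ, hφc, hl, hl'⟩ := hf.exists_smooth_approx hfL hfL'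
  have hmem : ∀ n, MemLp (φ n) 2 volume := fun n =>
    (hφ n).continuous.memLp_of_hasCompactSupport (hφc n)
  have hmem' : ∀ n, MemLp (fderiv ℝ (φ n)) 2 volume := fun n =>
    ((hφ n).continuous_fderiv (by simp)).memLp_of_hasCompactSupport ((hφc n).fderiv (𝕜 := ℝ))
  have h1 := tendsto_integral_mul_of_L2 hmem (fun _ => hgL'.clm_apply_const v) hfL
    (hgL'.clm_apply_const v) hl (by simp)
  have h2 := tendsto_integral_mul_of_L2 (fun n => (hmem' n).clm_apply_const v) (fun _ => hgL)
    (hfL'.clm_apply_const v) hgL (tendsto_eLpNorm_clm_apply_sub hl' v) (by simp)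
  refine tendsto_nhds_unique h1 (h2.neg.congr fun n => ?_)
  have := hg.2.2 ⟨φ n, hφ n, hφc n, by simp⟩ v
  rw [neg_eq_iff_eq_neg]
  exact this

theorem tendsto_eLpNorm_four_sub {f : E3 → ℝ} {f' : E3 → E3 →L[ℝ] ℝ} {φ : ℕ → E3 → ℝ}
    (hf : HasWeakFDeriv f f') (hfL : MemLp f 2 volume) (hfL' : MemLp f' 2 volume)
    (hφ : ∀ n, ContDiff ℝ (⊤ : ℕ∞) (φ n)) (hφc : ∀ n, HasCompactSupport (φ n))
    (hl : Tendsto (fun n => eLpNorm (φ n - f) 2 volume) atTop (𝓝 0))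
    (hl' : Tendsto (fun n => eLpNorm (fderiv ℝ (φ n) - f') 2 volume) atTop (𝓝 0)) :
    Tendsto (fun n => eLpNorm (φ n - f) 4 volume) atTop (𝓝 0) := by
  have hmem : ∀ n, MemLp (φ n) 2 volume := fun n =>
    (hφ n).continuous.memLp_of_hasCompactSupport (hφc n)
  have hmem' : ∀ n, MemLp (fderiv ℝ (φ n)) 2 volume := fun n =>
    ((hφ n).continuous_fderiv (by simp)).memLp_of_hasCompactSupport ((hφc n).fderiv (𝕜 := ℝ))
  refine tendsto_eLpNorm_four (fun n => (hmem n).1.sub hfL.1) hl ?_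
  have h1 : Tendsto (fun n => sobolevConst * eLpNorm (fderiv ℝ (φ n) - f') 2 volume) atTop
      (𝓝 (sobolevConst * 0)) := ENNReal.Tendsto.const_mul hl' (by simp)
  rw [mul_zero] at h1
  exact tendsto_of_tendsto_of_tendsto_of_le_of_le tendsto_const_nhds h1 (fun _ => zero_le)
    fun n => ((hasWeakFDeriv_of_contDiff ((hφ n).of_le (by simp))).sub hf).eLpNorm_six_le
      ((hmem n).sub hfL) ((hmem' n).sub hfL')

theorem integral_trilinear_of_contDiff {a b c : E3 → ℝ} (ha : ContDiff ℝ 1 a) (hb : ContDiff ℝ 1 b)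
    (hc : ContDiff ℝ 1 c) (hca : HasCompactSupport a) (v : E3) :
    ∫ x, fderiv ℝ a x v * (b x * c x)
      = - (∫ x, fderiv ℝ b x v * (a x * c x)) - ∫ x, fderiv ℝ c x v * (a x * b x) := by
  have hcont : ∀ {k : E3 → ℝ}, ContDiff ℝ 1 k → Continuous fun x => fderiv ℝ k x v := fun hk =>
    (hk.continuous_fderiv one_ne_zero).clm_apply continuous_const
  have hint : ∀ {k l : E3 → ℝ}, HasCompactSupport k → Continuous k → Continuous l →
      Integrable (fun x => k x * l x) := fun hk h1 h2 =>
    (h1.mul h2).integrable_of_hasCompactSupport hk.mul_right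
  have hd : ∀ x, fderiv ℝ (fun x => b x * c x) x v = b x * fderiv ℝ c x v + c x * fderiv ℝ b x v :=
    fun x => by
      rw [fderiv_fun_mul (hb.differentiable one_ne_zero x) (hc.differentiable one_ne_zero x)]
      simp
  have hbc := hb.mul hc
  have h := integral_mul_fderiv_eq_neg_fderiv_mul_of_integrable (μ := volume) (f := a)
    (g := fun x => b x * c x) (v := v)
    (hint (hca.fderiv_apply (𝕜 := ℝ) v) (hcont ha) hbc.continuous)
    (hint hca ha.continuous (hcont hbc)) (hint hca ha.continuous hbc.continuous)
    (fun x _ => ha.differentiable one_ne_zero x) (fun x _ => hbc.differentiable one_ne_zero x)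
  simp only [hd, mul_add] at h
  rw [integral_add (hint hca ha.continuous (l := fun x => b x * fderiv ℝ c x v)
    (hb.continuous.mul (hcont hc))) (hint hca ha.continuous (l := fun x => c x * fderiv ℝ b x v)
    (hc.continuous.mul (hcont hb)))] at h
  have e1 : ∫ x, fderiv ℝ b x v * (a x * c x) = ∫ x, a x * (c x * fderiv ℝ b x v) :=
    integral_congr_ae (.of_forall fun x => by ring)
  have e2 : ∫ x, fderiv ℝ c x v * (a x * b x) = ∫ x, a x * (b x * fderiv ℝ c x v) :=
    integral_congr_ae (.of_forall fun x => by ring)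
  rw [e1, e2]
  linarith

/-- Integration by parts for a product of three `H¹(ℝ³)` functions. The products are integrable
because `H¹(ℝ³) ⊆ L⁴(ℝ³)`. -/
theorem HasWeakFDeriv.integral_trilinear {a b c : E3 → ℝ} {a' b' c' : E3 → E3 →L[ℝ] ℝ}
    (ha : HasWeakFDeriv a a') (hb : HasWeakFDeriv b b') (hc : HasWeakFDeriv c c')
    (haL : MemLp a 2 volume) (haL' : MemLp a' 2 volume) (hbL : MemLp b 2 volume)
    (hbL' : MemLp b' 2 volume) (hcL : MemLp c 2 volume) (hcL' : MemLp c' 2 volume) (v : E3) :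
    ∫ x, a' x v * (b x * c x)
      = - (∫ x, b' x v * (a x * c x)) - ∫ x, c' x v * (a x * b x) := by
  obtain ⟨α, hα, hαc, hαl, hαl'⟩ := ha.exists_smooth_approx haL haL'
  obtain ⟨β, hβ, hβc, hβl, hβl'⟩ := hb.exists_smooth_approx hbL hbL'
  obtain ⟨γ, hγ, hγc, hγl, hγl'⟩ := hc.exists_smooth_approx hcL hcL'
  have := holderTriple_four_four_two
  have hα4 := tendsto_eLpNorm_four_sub ha haL haL' hα hαc hαl hαl'
  have hβ4 := tendsto_eLpNorm_four_sub hb hbL hbL' hβ hβc hβl hβl'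
  have hγ4 := tendsto_eLpNorm_four_sub hc hcL hcL' hγ hγc hγl hγl'
  have ha4 := ha.memLp_four haL haL'
  have hb4 := hb.memLp_four hbL hbL'
  have hc4 := hc.memLp_four hcL hcL'
  have hmem : ∀ {k : ℕ → E3 → ℝ} {p : ℝ≥0∞}, (∀ n, ContDiff ℝ (⊤ : ℕ∞) (k n)) →
      (∀ n, HasCompactSupport (k n)) → ∀ n, MemLp (k n) p volume := fun h1 h2 n =>
    (h1 n).continuous.memLp_of_hasCompactSupport (h2 n)
  have hmem' : ∀ {k : ℕ → E3 → ℝ}, (∀ n, ContDiff ℝ (⊤ : ℕ∞) (k n)) →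
      (∀ n, HasCompactSupport (k n)) → ∀ n, MemLp (fun x => fderiv ℝ (k n) x v) 2 volume :=
    fun h1 h2 n => (((h1 n).continuous_fderiv (by simp)).clm_apply
      continuous_const).memLp_of_hasCompactSupport ((h2 n).fderiv_apply (𝕜 := ℝ) v)
  -- Each of the three terms converges along the smooth approximations.
  have key : ∀ {k l m : ℕ → E3 → ℝ} {l₀ m₀ : E3 → ℝ} {k' : E3 → E3 →L[ℝ] ℝ},
      (∀ n, ContDiff ℝ (⊤ : ℕ∞) (k n)) → (∀ n, HasCompactSupport (k n)) →
      (∀ n, ContDiff ℝ (⊤ : ℕ∞) (l n)) → (∀ n, HasCompactSupport (l n)) →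
      (∀ n, ContDiff ℝ (⊤ : ℕ∞) (m n)) → (∀ n, HasCompactSupport (m n)) →
      Tendsto (fun n => eLpNorm (fderiv ℝ (k n) - k') 2 volume) atTop (𝓝 0) →
      Tendsto (fun n => eLpNorm (l n - l₀) 4 volume) atTop (𝓝 0) →
      Tendsto (fun n => eLpNorm (m n - m₀) 4 volume) atTop (𝓝 0) →
      MemLp k' 2 volume → MemLp l₀ 4 volume → MemLp m₀ 4 volume →
      Tendsto (fun n => ∫ x, fderiv ℝ (k n) x v * (l n x * m n x)) atTop
        (𝓝 (∫ x, k' x v * (l₀ x * m₀ x))) := by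
    intro k l m l₀ m₀ k' hk hkc hl hlc hm hmc hk' hl4 hm4 hkL hlL hmL
    refine tendsto_integral_mul_of_L2 (b := fun n => l n * m n) (b' := l₀ * m₀)
      (hmem' hk hkc) (fun n => (hmem hm hmc n (p := 4)).mul (hmem hl hlc n (p := 4)))
      (hkL.clm_apply_const v) (hmL.mul hlL) (tendsto_eLpNorm_clm_apply_sub hk' v) ?_
    exact tendsto_eLpNorm_mul_sub one_le_two (fun n => (hmem hl hlc n (p := 4)).1)
      (fun n => (hmem hm hmc n (p := 4)).1) hlL hmL hl4 hm4
  have t1 := key hα hαc hβ hβc hγ hγc hαl' hβ4 hγ4 haL' hb4 hc4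
  have t2 := key hβ hβc hα hαc hγ hγc hβl' hα4 hγ4 hbL' ha4 hc4
  have t3 := key hγ hγc hα hαc hβ hβc hγl' hα4 hβ4 hcL' ha4 hb4
  refine tendsto_nhds_unique t1 ((t2.neg.sub t3).congr fun n => ?_)
  exact (integral_trilinear_of_contDiff ((hα n).of_le (by simp)) ((hβ n).of_le (by simp))
    ((hγ n).of_le (by simp)) (hαc n) v).symm

end IntegrationByParts

/-! ### The equations at a fixed time -/

section Pointwise

/-- The entry `∂ⱼuᵢ` of the Jacobian matrix, as a linear functional of the derivative of `u`. -/
noncomputable def jacobianEntry (i j : Fin 3) : (E3 →L[ℝ] E3) →L[ℝ] ℝ :=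
  (EuclideanSpace.proj i : E3 →L[ℝ] ℝ).comp
    (ContinuousLinearMap.apply ℝ E3 (EuclideanSpace.single j (1 : ℝ)))

theorem jacobianEntry_apply (i j : Fin 3) (A : E3 →L[ℝ] E3) :
    jacobianEntry i j A = A (EuclideanSpace.single j 1) i := rfl

/-- The squared Frobenius norm of the Jacobian matrix. -/
noncomputable def frobeniusSq (A : E3 →L[ℝ] E3) : ℝ :=
  ∑ i, ∑ j, jacobianEntry i j A * jacobianEntry i j A

theorem inner_E3 (x y : E3) : inner ℝ x y = ∑ i, x i * y i := by
  rw [PiLp.inner_apply]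
  exact Finset.sum_congr rfl fun i _ => mul_comm _ _

theorem clm_apply_eq_sum {G : Type*} [NormedAddCommGroup G] [NormedSpace ℝ G] (A : E3 →L[ℝ] G)
    (w : E3) : A w = ∑ j, w j • A (EuclideanSpace.single j 1) := by
  conv_lhs => rw [← (EuclideanSpace.basisFun (Fin 3) ℝ).sum_repr w]
  simp

theorem clm_apply_apply_eq_sum (A : E3 →L[ℝ] E3) (w : E3) (i : Fin 3) :
    A w i = ∑ j, w j * jacobianEntry i j A := by
  rw [clm_apply_eq_sum A w]
  simp [jacobianEntry_apply, Fin.sum_univ_three]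

theorem divOf_eq_sum (A : E3 →L[ℝ] E3) : divOf A = ∑ i, jacobianEntry i i A := rfl

theorem frobeniusSq_nonneg (A : E3 →L[ℝ] E3) : 0 ≤ frobeniusSq A :=
  Finset.sum_nonneg fun _ _ => Finset.sum_nonneg fun _ _ => mul_self_nonneg _

theorem norm_sq_le_frobeniusSq (A : E3 →L[ℝ] E3) : ‖A‖ ^ 2 ≤ frobeniusSq A := by
  have h : ‖A‖ ≤ √(frobeniusSq A) := by
    refine A.opNorm_le_bound (Real.sqrt_nonneg _) fun w => ?_
    rw [← Real.sqrt_sq (norm_nonneg w), ← Real.sqrt_mul (frobeniusSq_nonneg A)]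
    refine Real.le_sqrt_of_sq_le ?_
    rw [EuclideanSpace.real_norm_sq_eq, EuclideanSpace.real_norm_sq_eq, frobeniusSq,
      Finset.sum_mul]
    refine Finset.sum_le_sum fun i _ => ?_
    rw [clm_apply_apply_eq_sum]
    refine (Finset.sum_mul_sq_le_sq_mul_sq _ _ _).trans_eq ?_
    rw [mul_comm]
    simp only [sq]
  calc ‖A‖ ^ 2 ≤ √(frobeniusSq A) ^ 2 := by gcongr
    _ = _ := Real.sq_sqrt (frobeniusSq_nonneg A)

theorem abs_jacobianEntry_le (i j : Fin 3) (A : E3 →L[ℝ] E3) : |jacobianEntry i j A| ≤ ‖A‖ := by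
  have h1 := PiLp.norm_apply_le (A (EuclideanSpace.single j 1)) i
  have h2 := A.le_opNorm (EuclideanSpace.single j 1)
  simp only [PiLp.norm_single, norm_one, mul_one] at h2
  exact h1.trans h2

theorem abs_divOf_le (A : E3 →L[ℝ] E3) : |divOf A| ≤ 3 * ‖A‖ := by
  rw [divOf_eq_sum]
  refine (Finset.abs_sum_le_sum_abs _ _).trans ?_
  refine (Finset.sum_le_sum fun i _ => abs_jacobianEntry_le i i A).trans_eq ?_
  simp

end Pointwise

section Slices

theorem MeasureTheory.MemLp.clm_comp {F G : Type*} [NormedAddCommGroup F] [NormedSpace ℝ F]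
    [NormedAddCommGroup G] [NormedSpace ℝ G] {p : ℝ≥0∞} {f' : E3 → E3 →L[ℝ] F}
    (h : MemLp f' p volume) (L : F →L[ℝ] G) : MemLp (fun x => L.comp (f' x)) p volume :=
  (ContinuousLinearMap.compL ℝ E3 F G L).comp_memLp' h

theorem MeasureTheory.MemLp.integrable_fun_mul {α : Type*} {m : MeasurableSpace α} {μ : Measure α}
    {f g : α → ℝ} (hf : MemLp f 2 μ) (hg : MemLp g 2 μ) : Integrable (fun x => f x * g x) μ :=
  hf.integrable_mul hg

variable {u : E3 → E3} {Du : E3 → E3 →L[ℝ] E3}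

theorem HasWeakFDeriv.coord (hu : HasWeakFDeriv u Du) (i : Fin 3) :
    HasWeakFDeriv (fun x => u x i) fun x => (EuclideanSpace.proj i : E3 →L[ℝ] ℝ).comp (Du x) :=
  hu.clm_comp (EuclideanSpace.proj i)

theorem memLp_coord {α : Type*} {m : MeasurableSpace α} {μ : Measure α} {p : ℝ≥0∞} {u : α → E3}
    (hu : MemLp u p μ) (i : Fin 3) : MemLp (fun x => u x i) p μ :=
  (EuclideanSpace.proj i : E3 →L[ℝ] ℝ).comp_memLp' hu

theorem memLp_jacobianEntry {α : Type*} {m : MeasurableSpace α} {μ : Measure α} {p : ℝ≥0∞}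
    {A : α → E3 →L[ℝ] E3} (hA : MemLp A p μ) (i j : Fin 3) :
    MemLp (fun x => jacobianEntry i j (A x)) p μ :=
  (jacobianEntry i j).comp_memLp' hA

theorem memLp_divOf {α : Type*} {m : MeasurableSpace α} {μ : Measure α} {p : ℝ≥0∞}
    {A : α → E3 →L[ℝ] E3} (hA : MemLp A p μ) : MemLp (fun x => divOf (A x)) p μ :=
  memLp_finsetSum _ fun i _ => memLp_jacobianEntry hA i i

theorem integrable_frobeniusSq {α : Type*} {m : MeasurableSpace α} {μ : Measure α}
    {A : α → E3 →L[ℝ] E3} (hA : MemLp A 2 μ) : Integrable (fun x => frobeniusSq (A x)) μ :=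
  integrable_finsetSum _ fun i _ => integrable_finsetSum _ fun j _ =>
    (memLp_jacobianEntry hA i j).integrable_mul (memLp_jacobianEntry hA i j)

theorem integrable_inner_of_memLp {α : Type*} {m : MeasurableSpace α} {μ : Measure α}
    {a b : α → E3} (ha : MemLp a 2 μ) (hb : MemLp b 2 μ) :
    Integrable (fun x => inner ℝ (a x) (b x)) μ := by
  simp_rw [inner_E3]
  exact integrable_finsetSum _ fun i _ => (memLp_coord ha i).integrable_mul (memLp_coord hb i)

theorem integrable_jacobianEntry_mul_mul (hu : HasWeakFDeriv u Du) (huL : MemLp u 2 volume)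
    (hDuL : MemLp Du 2 volume) (i j k l : Fin 3) :
    Integrable (fun x => jacobianEntry i j (Du x) * (u x k * u x l)) := by
  have := holderTriple_four_four_two
  have h4 := fun k => memLp_coord (hu.memLp_four huL hDuL) k
  exact (memLp_jacobianEntry hDuL i j).integrable_fun_mul ((h4 l).mul (r := 2) (h4 k))

theorem inner_convection_eq_sum (A : E3 →L[ℝ] E3) (w : E3) :
    inner ℝ (A w + (1 / 2 : ℝ) • (divOf A • w)) w
      = ∑ i, ∑ j, (jacobianEntry i j A * (w j * w i)
        + 1 / 2 * (jacobianEntry j j A * (w i * w i))) := by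
  rw [inner_E3]
  refine Finset.sum_congr rfl fun i _ => ?_
  rw [PiLp.add_apply, clm_apply_apply_eq_sum, PiLp.smul_apply, PiLp.smul_apply, divOf_eq_sum]
  simp only [smul_eq_mul, Finset.sum_mul, Finset.mul_sum, add_mul, ← Finset.sum_add_distrib]
  exact Finset.sum_congr rfl fun j _ => by ring

/-- The skew-symmetrized convection term does no work. -/
theorem HasWeakFDeriv.integral_convection_eq_zero (hu : HasWeakFDeriv u Du)
    (huL : MemLp u 2 volume) (hDuL : MemLp Du 2 volume) :
    Integrable (fun x => inner ℝ (Du x (u x) + (1 / 2 : ℝ) • (divOf (Du x) • u x)) (u x)) ∧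
    ∫ x, inner ℝ (Du x (u x) + (1 / 2 : ℝ) • (divOf (Du x) • u x)) (u x) = 0 := by
  simp_rw [inner_convection_eq_sum]
  have hi := integrable_jacobianEntry_mul_mul hu huL hDuL
  have hi' : ∀ i j, Integrable fun x => jacobianEntry i j (Du x) * (u x j * u x i)
      + 1 / 2 * (jacobianEntry j j (Du x) * (u x i * u x i)) := fun i j =>
    (hi i j j i).add ((hi j j i i).const_mul _)
  refine ⟨integrable_finsetSum _ fun i _ => integrable_finsetSum _ fun j _ => hi' i j, ?_⟩
  rw [integral_finsetSum _ fun i _ => integrable_finsetSum _ fun j _ => hi' i j]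
  refine Finset.sum_eq_zero fun i _ => ?_
  rw [integral_finsetSum _ fun j _ => hi' i j]
  refine Finset.sum_eq_zero fun j _ => ?_
  rw [integral_add (hi i j j i) ((hi j j i i).const_mul _), integral_const_mul]
  have ht := (hu.coord j).integral_trilinear (hu.coord i) (hu.coord i) (memLp_coord huL j)
    (hDuL.clm_comp (EuclideanSpace.proj j)) (memLp_coord huL i)
    (hDuL.clm_comp (EuclideanSpace.proj i)) (memLp_coord huL i)
    (hDuL.clm_comp (EuclideanSpace.proj i)) (EuclideanSpace.single j 1)
  have e1 : ∀ k l : Fin 3, ∀ x, (EuclideanSpace.proj k : E3 →L[ℝ] ℝ).comp (Du x)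
      (EuclideanSpace.single l 1) = jacobianEntry k l (Du x) := fun _ _ _ => rfl
  simp only [e1] at ht
  linarith

/-- Integration by parts in the pressure term. -/
theorem HasWeakFDeriv.integral_inner_gradOf {p : E3 → ℝ} {Dp : E3 → E3 →L[ℝ] ℝ}
    (hu : HasWeakFDeriv u Du) (huL : MemLp u 2 volume) (hDuL : MemLp Du 2 volume)
    (hp : HasWeakFDeriv p Dp) (hpL : MemLp p 2 volume) (hDpL : MemLp Dp 2 volume) :
    ∫ x, inner ℝ (gradOf (Dp x)) (u x) = - ∫ x, p x * divOf (Du x) := by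
  have h1 : ∀ x, inner ℝ (gradOf (Dp x)) (u x)
      = ∑ i, u x i * Dp x (EuclideanSpace.single i 1) := fun x => by
    rw [gradOf, InnerProductSpace.toDual_symm_apply, clm_apply_eq_sum]; rfl
  simp_rw [h1, divOf_eq_sum, Finset.mul_sum]
  rw [integral_finsetSum _ fun i _ =>
      (memLp_coord huL i).integrable_fun_mul (hDpL.clm_apply_const _),
    integral_finsetSum _ fun i _ => hpL.integrable_fun_mul (memLp_jacobianEntry hDuL i i),
    ← Finset.sum_neg_distrib]
  refine Finset.sum_congr rfl fun i _ => ?_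
  rw [(hu.coord i).integral_mul_eq_neg hp (memLp_coord huL i)
    (hDuL.clm_comp (EuclideanSpace.proj i)) hpL hDpL]
  congr 1
  exact integral_congr_ae (.of_forall fun x => mul_comm _ _)

/-- Integration by parts in the viscous term. -/
theorem HasWeakFDeriv.integral_inner_laplacianOf {D2u : E3 → E3 →L[ℝ] E3 →L[ℝ] E3}
    (hu : HasWeakFDeriv u Du) (huL : MemLp u 2 volume) (hDuL : MemLp Du 2 volume)
    (hDu : HasWeakFDeriv Du D2u) (hD2uL : MemLp D2u 2 volume) :
    ∫ x, inner ℝ (laplacianOf (D2u x)) (u x) = - ∫ x, frobeniusSq (Du x) := by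
  have h1 : ∀ x, inner ℝ (laplacianOf (D2u x)) (u x)
      = ∑ i, ∑ j, u x i * (jacobianEntry i j).comp (D2u x) (EuclideanSpace.single j 1) :=
    fun x => by
      rw [inner_E3]
      refine Finset.sum_congr rfl fun i _ => ?_
      rw [mul_comm, ← Finset.mul_sum]
      simp [laplacianOf, jacobianEntry_apply, Fin.sum_univ_three]
  have hL : ∀ i j, MemLp (fun x => (jacobianEntry i j).comp (D2u x)) 2 volume := fun i j =>

    hD2uL.clm_comp (jacobianEntry i j)
  have hi : ∀ i j, Integrable fun x =>
      u x i * (jacobianEntry i j).comp (D2u x) (EuclideanSpace.single j 1) := fun i j =>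
    (memLp_coord huL i).integrable_fun_mul ((hL i j).clm_apply_const _)
  have hi' : ∀ i j, Integrable fun x => jacobianEntry i j (Du x) * jacobianEntry i j (Du x) :=
    fun i j => (memLp_jacobianEntry hDuL i j).integrable_fun_mul (memLp_jacobianEntry hDuL i j)
  simp_rw [h1, frobeniusSq]
  rw [integral_finsetSum _ fun i _ => integrable_finsetSum _ fun j _ => hi i j,
    integral_finsetSum _ fun i _ => integrable_finsetSum _ fun j _ => hi' i j,
    ← Finset.sum_neg_distrib]
  refine Finset.sum_congr rfl fun i _ => ?_
  rw [integral_finsetSum _ fun j _ => hi i j, integral_finsetSum _ fun j _ => hi' i j,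
    ← Finset.sum_neg_distrib]
  refine Finset.sum_congr rfl fun j _ => ?_
  rw [(hu.coord i).integral_mul_eq_neg (hDu.clm_comp (jacobianEntry i j)) (memLp_coord huL i)
    (hDuL.clm_comp (EuclideanSpace.proj i)) (memLp_jacobianEntry hDuL i j) (hL i j)]
  rfl

theorem memLp_gradOf {Dp : E3 → E3 →L[ℝ] ℝ} (h : MemLp Dp 2 volume) :
    MemLp (fun x => gradOf (Dp x)) 2 volume := by
  refine ⟨(InnerProductSpace.toDual ℝ E3).symm.continuous.comp_aestronglyMeasurable h.1, ?_⟩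
  refine lt_of_eq_of_lt (eLpNorm_congr_norm_ae (.of_forall fun x => ?_)) h.2
  exact (InnerProductSpace.toDual ℝ E3).symm.norm_map (Dp x)

theorem memLp_laplacianOf {D2u : E3 → E3 →L[ℝ] E3 →L[ℝ] E3} (h : MemLp D2u 2 volume) :
    MemLp (fun x => laplacianOf (D2u x)) 2 volume :=
  memLp_finsetSum _ fun i _ => (ContinuousLinearMap.apply ℝ E3
    (EuclideanSpace.single i (1 : ℝ))).comp_memLp' (h.clm_apply_const _)

/-- The momentum equation tested with `u`, at a fixed time. -/
theorem integral_inner_dtu_eq {dtu : E3 → E3} {D2u : E3 → E3 →L[ℝ] E3 →L[ℝ] E3} {p : E3 → ℝ}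
    {Dp : E3 → E3 →L[ℝ] ℝ}
    (hu : HasWeakFDeriv u Du) (huL : MemLp u 2 volume) (hDuL : MemLp Du 2 volume)
    (hDu : HasWeakFDeriv Du D2u) (hD2uL : MemLp D2u 2 volume)
    (hp : HasWeakFDeriv p Dp) (hpL : MemLp p 2 volume) (hDpL : MemLp Dp 2 volume)
    (h : ∀ᵐ x, dtu x + Du x (u x) + (1 / 2 : ℝ) • (divOf (Du x) • u x) + gradOf (Dp x)
      - laplacianOf (D2u x) = 0) :
    ∫ x, inner ℝ (dtu x) (u x) = (∫ x, p x * divOf (Du x)) - ∫ x, frobeniusSq (Du x) := by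
  obtain ⟨hNi, hN⟩ := hu.integral_convection_eq_zero huL hDuL
  have hG := hu.integral_inner_gradOf huL hDuL hp hpL hDpL
  have hL := hu.integral_inner_laplacianOf huL hDuL hDu hD2uL
  have hGi := integrable_inner_of_memLp (memLp_gradOf hDpL) huL
  have hLi := integrable_inner_of_memLp (memLp_laplacianOf hD2uL) huL
  have key : ∫ x, inner ℝ (dtu x) (u x) = ∫ x, (inner ℝ (laplacianOf (D2u x)) (u x)
      - inner ℝ (gradOf (Dp x)) (u x)
      - inner ℝ (Du x (u x) + (1 / 2 : ℝ) • (divOf (Du x) • u x)) (u x)) := by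
    refine integral_congr_ae (h.mono fun x hx => ?_)
    dsimp only
    rw [← inner_sub_left, ← inner_sub_left]
    congr 1
    rw [← sub_eq_zero, ← hx]
    abel
  have hLGi : Integrable fun x => inner ℝ (laplacianOf (D2u x)) (u x)
      - inner ℝ (gradOf (Dp x)) (u x) := hLi.sub hGi
  rw [key, integral_sub hLGi hNi, integral_sub hLi hGi, hN, hG, hL]
  ring

end Slices

/-! ### Regularity in time -/

section OneDimensional

theorem AbsolutelyContinuousOnInterval.integral_eq_sub_of_ae_hasDerivAt {f f' : ℝ → ℝ} {a b : ℝ}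
    (hab : a ≤ b) (hf : AbsolutelyContinuousOnInterval f a b)
    (hf' : ∀ᵐ s, s ∈ Ioo a b → HasDerivAt f (f' s) s) :
    ∫ s in a..b, f' s = f b - f a := by
  rw [← hf.integral_deriv_eq_sub]
  refine intervalIntegral.integral_congr_ae ?_
  filter_upwards [hf', compl_mem_ae_iff.2 (measure_singleton (μ := volume) b)] with s hs hsb hsab
  rw [uIoc_of_le hab] at hsab
  exact (hs ⟨hsab.1, lt_of_le_of_ne hsab.2 hsb⟩).deriv.symm

theorem ContDiffOn.hasDerivAt_derivWithin_Icc {k : ℝ → ℝ} {a b s : ℝ}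
    (hk : ContDiffOn ℝ 1 k (Icc a b)) (hs : s ∈ Ioo a b) :
    HasDerivAt k (derivWithin k (Icc a b) s) s :=
  ((hk.differentiableOn one_ne_zero s (Ioo_subset_Icc_self hs)).hasDerivWithinAt).hasDerivAt
    (Icc_mem_nhds hs.1 hs.2)

variable {T t : ℝ} {g h : ℝ → ℝ}

theorem absolutelyContinuous_const_add_integral (c : ℝ) (hh : IntervalIntegrable h volume 0 T) :
    AbsolutelyContinuousOnInterval (fun s => c + ∫ r in 0..s, h r) 0 T :=
  (contDiffOn_const.absolutelyContinuousOnInterval).add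
    (hh.absolutelyContinuousOnInterval_intervalIntegral left_mem_uIcc)

theorem ae_hasDerivAt_const_add_integral (c : ℝ) (hh : IntervalIntegrable h volume 0 T) :
    ∀ᵐ s, s ∈ Ioo 0 T → HasDerivAt (fun s => c + ∫ r in 0..s, h r) (h s) s := by
  filter_upwards [hh.ae_hasDerivAt_integral] with s hs hsT
  refine (hs ?_ 0 left_mem_uIcc).const_add c
  rw [uIcc_of_le (hsT.1.trans hsT.2).le]
  exact Ioo_subset_Icc_self hsT

theorem weighted_sq_sub_eq_integral {k : ℝ → ℝ} (hk : ContDiffOn ℝ 1 k (Icc 0 T))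
    (ht : t ∈ Icc 0 T) (hh : IntervalIntegrable h volume 0 T) (c : ℝ)
    (hg : ∀ s, g s = c + ∫ r in 0..s, h r) :
    k t * (g t * g t) - k 0 * (g 0 * g 0)
      = ∫ s in 0..t, (derivWithin k (Icc 0 T) s * (g s * g s) + 2 * (k s * (g s * h s))) := by
  obtain rfl : g = fun s => c + ∫ r in 0..s, h r := funext hg
  have hsub : uIcc 0 t ⊆ uIcc 0 T := by
    rw [uIcc_of_le ht.1, uIcc_of_le (ht.1.trans ht.2)]; exact Icc_subset_Icc_right ht.2
  have hgac := (absolutelyContinuous_const_add_integral c hh).mono hsub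
  have hkac : AbsolutelyContinuousOnInterval k 0 t :=
    ContDiffOn.absolutelyContinuousOnInterval (hk.mono (by
      rw [uIcc_of_le ht.1]; exact Icc_subset_Icc_right ht.2))
  refine (AbsolutelyContinuousOnInterval.integral_eq_sub_of_ae_hasDerivAt ht.1
    (hkac.fun_mul (hgac.fun_mul hgac)) ?_).symm
  filter_upwards [ae_hasDerivAt_const_add_integral c hh] with s hs hst
  have hsT : s ∈ Ioo 0 T := ⟨hst.1, hst.2.trans_le ht.2⟩
  have hd := hs hsT
  refine ((hk.hasDerivAt_derivWithin_Icc hsT).mul (hd.mul hd)).congr_deriv ?_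
  simp only [Pi.mul_apply]
  ring

theorem integral_mul_test_eq_neg {k ψ ψ' : ℝ → ℝ} (hT : 0 ≤ T) (hk : ContDiffOn ℝ 1 k (Icc 0 T))
    (hψ : ∀ s, HasDerivAt ψ (ψ' s) s) (hψc : ContDiff ℝ 1 ψ) (hψ0 : ψ 0 = 0) (hψT : ψ T = 0)
    (hh : IntervalIntegrable h volume 0 T) (c : ℝ) (hg : ∀ s, g s = c + ∫ r in 0..s, h r) :
    ∫ s in 0..T, (k s * h s * ψ s + (k s * g s * ψ' s
      + derivWithin k (Icc 0 T) s * g s * ψ s)) = 0 := by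
  obtain rfl : g = fun s => c + ∫ r in 0..s, h r := funext hg
  have hgac := absolutelyContinuous_const_add_integral c hh
  have hkac : AbsolutelyContinuousOnInterval k 0 T :=
    ContDiffOn.absolutelyContinuousOnInterval (by rwa [uIcc_of_le hT])
  have hψac : AbsolutelyContinuousOnInterval ψ 0 T := hψc.contDiffOn.absolutelyContinuousOnInterval
  refine (AbsolutelyContinuousOnInterval.integral_eq_sub_of_ae_hasDerivAt hT
    (hkac.fun_mul (hgac.fun_mul hψac)) ?_).trans (by simp [hψ0, hψT])
  filter_upwards [ae_hasDerivAt_const_add_integral c hh] with s hs hsT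
  refine ((hk.hasDerivAt_derivWithin_Icc hsT).mul ((hs hsT).mul (hψ s))).congr_deriv ?_
  simp only [Pi.mul_apply]
  ring

end OneDimensional

section Slab

variable {T : ℝ} {F : Type*} [NormedAddCommGroup F]

theorem slabMeasure_eq_prod (T : ℝ) :
    slabMeasure T = (volume.restrict (Ioo 0 T)).prod (volume : Measure E3) := by
  have h := Measure.prod_restrict (μ := (volume : Measure ℝ)) (ν := (volume : Measure E3))
    (Ioo 0 T) univ
  rw [Measure.restrict_univ] at h
  exact h.symm

theorem slabMeasure_mono {t : ℝ} (ht : t ≤ T) : slabMeasure t ≤ slabMeasure T :=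
  Measure.restrict_mono (prod_mono (Ioo_subset_Ioo_right ht) Subset.rfl) le_rfl

theorem MeasureTheory.MemLp.ae_prodMk_left {α β : Type*} {mα : MeasurableSpace α}
    {mβ : MeasurableSpace β} {μ : Measure α} {ν : Measure β} [SFinite ν] {f : α × β → F}
    (hf : MemLp f 2 (μ.prod ν)) : ∀ᵐ x ∂μ, MemLp (fun y => f (x, y)) 2 ν := by
  have hm : AEMeasurable (fun z => ‖f z‖ₑ ^ 2) (μ.prod ν) := hf.1.enorm.pow_const 2
  have hfin : ∫⁻ x, ∫⁻ y, ‖f (x, y)‖ₑ ^ 2 ∂ν ∂μ < ∞ := by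
    rw [← lintegral_prod _ hm, ← eLpNorm_two_sq]
    exact ENNReal.pow_lt_top hf.2
  filter_upwards [hf.1.prodMk_left, ae_lt_top' hm.lintegral_prod_right' hfin.ne] with x h1 h2
  refine ⟨h1, ?_⟩
  rw [← eLpNorm_two_sq] at h2
  exact (ENNReal.pow_lt_top_iff.1 h2).resolve_right two_ne_zero

theorem MeasureTheory.MemLp.ae_prodMk_right {α β : Type*} {mα : MeasurableSpace α}
    {mβ : MeasurableSpace β} {μ : Measure α} {ν : Measure β} [SFinite μ] [SFinite ν]
    {f : α × β → F} (hf : MemLp f 2 (μ.prod ν)) : ∀ᵐ y ∂ν, MemLp (fun x => f (x, y)) 2 μ :=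
  (hf.comp_measurePreserving Measure.measurePreserving_swap).ae_prodMk_left

theorem ae_ae_swap_of_ae_prod {α β : Type*} {mα : MeasurableSpace α}
    {mβ : MeasurableSpace β} {μ : Measure α} {ν : Measure β} [SFinite μ] [SFinite ν]
    {p : α × β → Prop} (h : ∀ᵐ z ∂μ.prod ν, p z) : ∀ᵐ y ∂ν, ∀ᵐ x ∂μ, p (x, y) := by
  have h' := (Measure.measurePreserving_swap (μ := ν) (ν := μ)).quasiMeasurePreserving.ae h
  exact Measure.ae_ae_of_ae_prod h'

theorem intervalIntegrable_of_memLp_two {h : ℝ → F} (hT : 0 ≤ T)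
    (hh : MemLp h 2 (volume.restrict (Ioo 0 T))) : IntervalIntegrable h volume 0 T := by
  rw [intervalIntegrable_iff_integrableOn_Ioo_of_le hT]
  exact hh.integrable one_le_two

theorem aestronglyMeasurable_time {k : ℝ → ℝ} (hk : ContinuousOn k (Icc 0 T)) :
    AEStronglyMeasurable (fun z : ℝ × E3 => k z.1) (slabMeasure T) := by
  rw [slabMeasure_eq_prod]
  exact ((hk.mono Ioo_subset_Icc_self).aestronglyMeasurable measurableSet_Ioo).comp_fst

theorem ae_slab_mem : ∀ᵐ z ∂(slabMeasure T), z.1 ∈ Ioo 0 T :=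
  (ae_restrict_mem (slab T).isOpen.measurableSet).mono fun _ hz => hz.1

theorem MeasureTheory.MemLp.time_mul {k : ℝ → ℝ} (hk : ContinuousOn k (Icc 0 T)) {f : ℝ × E3 → ℝ}
    (hf : MemLp f 2 (slabMeasure T)) : MemLp (fun z => k z.1 * f z) 2 (slabMeasure T) := by
  obtain ⟨C, hC⟩ := isCompact_Icc.exists_bound_of_continuousOn hk
  refine hf.of_le_mul (c := C) ((aestronglyMeasurable_time hk).mul hf.1) ?_
  filter_upwards [ae_slab_mem] with z hz
  rw [norm_mul]
  gcongr
  exact hC _ (Ioo_subset_Icc_self hz)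

end Slab

section TimeRegularity

variable {T : ℝ}

theorem IsH1L2.ae_intervalIntegrable {F : Type*} [NormedAddCommGroup F] [NormedSpace ℝ F]
    {f dtf : ℝ → E3 → F} (hT : 0 ≤ T) (h : IsH1L2 T f dtf) :
    ∀ᵐ x, IntervalIntegrable (fun s => dtf s x) volume 0 T := by
  have h2 := h.memLp_deriv
  rw [slabMeasure_eq_prod] at h2
  exact h2.ae_prodMk_right.mono fun x hx => intervalIntegrable_of_memLp_two hT hx

theorem IsH1L2.coord {f dtf : ℝ → E3 → E3} (hT : 0 ≤ T) (h : IsH1L2 T f dtf) (i : Fin 3) :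
    IsH1L2 T (fun t x => f t x i) (fun t x => dtf t x i) where
  memLp := memLp_coord h.memLp i
  memLp_deriv := memLp_coord h.memLp_deriv i
  memLp_slice t ht := memLp_coord (h.memLp_slice t ht) i
  eq_add_integral t ht := by
    filter_upwards [h.eq_add_integral t ht, h.ae_intervalIntegrable hT] with x hx hi
    have hi' : IntervalIntegrable (fun s => dtf s x) volume 0 t :=
      hi.mono_set (by
        rw [uIcc_of_le ht.1, uIcc_of_le hT]; exact Icc_subset_Icc_right ht.2)
    have := (EuclideanSpace.proj i : E3 →L[ℝ] ℝ).intervalIntegral_comp_comm hi'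
    rw [hx, PiLp.add_apply]
    exact congrArg _ this.symm

/-- For almost every `x`, the function `f(·, x)` agrees almost everywhere with an absolutely
continuous function. The hypothesis provides a null set of points `x` for every time `t`; the
order of the quantifiers is exchanged by measurability. -/
theorem IsH1L2.ae_ae_eq_add_integral {f dtf : ℝ → E3 → ℝ} (hT : 0 ≤ T) (h : IsH1L2 T f dtf) :
    ∀ᵐ x, ∀ᵐ s ∂(volume.restrict (Ioo 0 T)), f s x = f 0 x + ∫ r in 0..s, dtf r x := by
  have h1 := h.memLp.1
  have h2 := h.memLp_deriv.1
  have h0 := (h.memLp_slice 0 ⟨le_rfl, hT⟩).1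
  rw [slabMeasure_eq_prod] at h1 h2
  obtain ⟨f₁, hf₁, he₁⟩ := h1
  obtain ⟨D, hD, heD⟩ := h2
  obtain ⟨f₀, hf₀, he₀⟩ := h0
  have hDint : ∀ᵐ x, ∀ s ∈ Ioo 0 T, ∫ r in 0..s, dtf r x = ∫ r in 0..s, D (r, x) := by
    filter_upwards [ae_ae_swap_of_ae_prod heD] with x hx s hs
    refine intervalIntegral.integral_congr_ae_restrict ?_
    refine ae_restrict_of_ae_restrict_of_subset ?_ hx
    rw [uIoc_of_le hs.1.le]
    exact fun r hr => ⟨hr.1, hr.2.trans_lt hs.2⟩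
  have hI : StronglyMeasurable fun z : ℝ × E3 =>
      ∫ r, (if 0 < r ∧ r ≤ z.1 then D (r, z.2) else 0) := by
    refine StronglyMeasurable.integral_prod_right (f := fun (z : ℝ × E3) (r : ℝ) =>
      if 0 < r ∧ r ≤ z.1 then D (r, z.2) else 0) ?_
    refine StronglyMeasurable.ite (p := fun w : (ℝ × E3) × ℝ => 0 < w.2 ∧ w.2 ≤ w.1.1) ?_
      (hD.comp_measurable (measurable_snd.prodMk (measurable_snd.comp measurable_fst)))
      stronglyMeasurable_const
    exact (measurableSet_lt measurable_const measurable_snd).inter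
      (measurableSet_le measurable_snd (measurable_fst.comp measurable_fst))
  have hIeq : ∀ s ∈ Ioo 0 T, ∀ x, ∫ r, (if 0 < r ∧ r ≤ s then D (r, x) else 0)
      = ∫ r in 0..s, D (r, x) := by
    intro s hs x
    rw [intervalIntegral.integral_of_le hs.1.le, ← integral_indicator measurableSet_Ioc]
    refine integral_congr_ae (.of_forall fun r => ?_)
    simp only [indicator_apply, mem_Ioc]
  have hset : MeasurableSet {z : ℝ × E3 | f₁ z = f₀ z.2
      + ∫ r, (if 0 < r ∧ r ≤ z.1 then D (r, z.2) else 0)} :=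
    hf₁.measurableSet_eq_fun ((hf₀.comp_measurable measurable_snd).add hI)
  have hae : ∀ᵐ s ∂(volume.restrict (Ioo 0 T)), ∀ᵐ x, f₁ (s, x) = f₀ x
      + ∫ r, (if 0 < r ∧ r ≤ s then D (r, x) else 0) := by
    filter_upwards [Measure.ae_ae_of_ae_prod he₁, ae_restrict_mem measurableSet_Ioo] with s hs hsT
    filter_upwards [hs, he₀, hDint, h.eq_add_integral s (Ioo_subset_Icc_self hsT)]
      with x e1 e2 e3 e4
    rw [← e1, ← e2, hIeq s hsT, ← e3 s hsT]
    exact e4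
  rw [Measure.ae_ae_comm (p := fun s x => f₁ (s, x) = f₀ x
      + ∫ r, (if 0 < r ∧ r ≤ s then D (r, x) else 0)) hset] at hae
  filter_upwards [hae, ae_ae_swap_of_ae_prod he₁, he₀, hDint] with x e1 e2 e3 e4
  filter_upwards [e1, e2, ae_restrict_mem measurableSet_Ioo] with s e5 e6 hsT
  rw [e6, e5, e3, e4 s hsT, hIeq s hsT]

theorem integral_slab_eq {t : ℝ} (ht : 0 ≤ t) {W : ℝ × E3 → ℝ} (hW : Integrable W (slabMeasure t)) :
    ∫ z, W z ∂(slabMeasure t) = ∫ x, ∫ s in 0..t, W (s, x) := by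
  rw [slabMeasure_eq_prod] at hW ⊢
  rw [integral_prod_symm _ hW]
  simp_rw [intervalIntegral.integral_of_le ht, integral_Ioc_eq_integral_Ioo]

/-- The derivative in time of `k(t) ‖f(t)‖²`, in integrated form. -/
theorem IsH1L2.weighted_integral_sq_sub {f dtf : ℝ → E3 → ℝ} (h : IsH1L2 T f dtf)
    {k : ℝ → ℝ} (hk : ContDiffOn ℝ 1 k (Icc 0 T)) {t : ℝ} (ht : t ∈ Icc 0 T) (hT : 0 < T) :
    Integrable (fun z : ℝ × E3 => derivWithin k (Icc 0 T) z.1 * (f z.1 z.2 * f z.1 z.2)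
        + 2 * (k z.1 * (f z.1 z.2 * dtf z.1 z.2))) (slabMeasure t) ∧
    k t * (∫ x, f t x * f t x) - k 0 * (∫ x, f 0 x * f 0 x)
      = ∫ z, (derivWithin k (Icc 0 T) z.1 * (f z.1 z.2 * f z.1 z.2)
        + 2 * (k z.1 * (f z.1 z.2 * dtf z.1 z.2))) ∂(slabMeasure t) := by
  have hk' := hk.continuousOn_derivWithin (uniqueDiffOn_Icc hT) le_rfl
  have hint : Integrable (fun z : ℝ × E3 => derivWithin k (Icc 0 T) z.1 * (f z.1 z.2 * f z.1 z.2)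
        + 2 * (k z.1 * (f z.1 z.2 * dtf z.1 z.2))) (slabMeasure T) := by
    have h1 := (h.memLp.time_mul hk').integrable_fun_mul h.memLp
    have h2 := (h.memLp.time_mul hk.continuousOn).integrable_fun_mul h.memLp_deriv
    simp only [mul_assoc] at h1 h2
    exact h1.add (h2.const_mul 2)
  have hint' := hint.mono_measure (slabMeasure_mono ht.2)
  refine ⟨hint', ?_⟩
  have hsl : ∀ s ∈ Icc 0 T, Integrable fun x => f s x * f s x := fun s hs =>
    (h.memLp_slice s hs).integrable_fun_mul (h.memLp_slice s hs)
  rw [integral_slab_eq ht.1 hint', ← integral_const_mul, ← integral_const_mul,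
    ← integral_sub ((hsl t ht).const_mul _) ((hsl 0 ⟨le_rfl, hT.le⟩).const_mul _)]
  refine integral_congr_ae ?_
  filter_upwards [h.ae_ae_eq_add_integral hT.le, h.ae_intervalIntegrable hT.le,
    h.eq_add_integral t ht] with x hx hi hxt
  have h1 := weighted_sq_sub_eq_integral hk ht hi (f 0 x) (fun s => rfl)
  rw [← hxt] at h1
  simp only [intervalIntegral.integral_same, add_zero] at h1
  rw [h1]
  refine intervalIntegral.integral_congr_ae_restrict ?_
  rw [uIoc_of_le ht.1, ← Measure.restrict_congr_set Ioo_ae_eq_Ioc]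
  filter_upwards [ae_restrict_of_ae_restrict_of_subset (Ioo_subset_Ioo_right ht.2) hx] with s hs
  rw [hs]

theorem hasDerivAt_test_time (φ : 𝓓(slab T, ℝ)) (s : ℝ) (x : E3) :
    HasDerivAt (fun s => φ (s, x)) (fderiv ℝ φ (s, x) (1, 0)) s := by
  have h1 : HasFDerivAt φ (fderiv ℝ φ (s, x)) (s, x) :=
    (φ.contDiff.differentiable (by simp) (s, x)).hasFDerivAt
  exact h1.comp_hasDerivAt s ((hasDerivAt_id s).prodMk (hasDerivAt_const s x))

theorem TestFunction.eq_zero_of_notMem_slab (φ : 𝓓(slab T, ℝ)) {z : ℝ × E3}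
    (hz : z.1 ∉ Ioo 0 T) : φ z = 0 := by
  by_contra hne
  exact hz (φ.tsupport_subset (subset_tsupport φ hne)).1

/-- The distributional identity `k ∂ₜf = ∂ₜ(k f) - k' f`. -/
theorem IsH1L2.integral_mul_test {f dtf : ℝ → E3 → ℝ} (h : IsH1L2 T f dtf)
    {k : ℝ → ℝ} (hk : ContDiffOn ℝ 1 k (Icc 0 T)) (hT : 0 < T) (φ : 𝓓(slab T, ℝ)) :
    ∫ z, k z.1 * dtf z.1 z.2 * φ z ∂(slabMeasure T)
      = - ((∫ z, k z.1 * f z.1 z.2 * fderiv ℝ φ z (1, 0) ∂(slabMeasure T))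
        + ∫ z, derivWithin k (Icc 0 T) z.1 * f z.1 z.2 * φ z ∂(slabMeasure T)) := by
  have hk' := hk.continuousOn_derivWithin (uniqueDiffOn_Icc hT) le_rfl
  have hφ' : MemLp (fun z => fderiv ℝ φ z (1, 0)) 2 (slabMeasure T) :=
    (ContinuousLinearMap.apply ℝ ℝ ((1, 0) : ℝ × E3)).comp_memLp' φ.memLp_fderiv_slab
  have i1 := (h.memLp_deriv.time_mul hk.continuousOn).integrable_fun_mul φ.memLp_slab
  have i2 := (h.memLp.time_mul hk.continuousOn).integrable_fun_mul hφ'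
  have i3 := (h.memLp.time_mul hk').integrable_fun_mul φ.memLp_slab
  have i4 : Integrable (fun z : ℝ × E3 => k z.1 * f z.1 z.2 * fderiv ℝ φ z (1, 0)
      + derivWithin k (Icc 0 T) z.1 * f z.1 z.2 * φ z) (slabMeasure T) := i2.add i3
  rw [← integral_add i2 i3, eq_neg_iff_add_eq_zero, ← integral_add i1 i4]
  refine (integral_slab_eq hT.le (i1.add i4)).trans ?_
  refine integral_eq_zero_of_ae ?_
  filter_upwards [h.ae_ae_eq_add_integral hT.le, h.ae_intervalIntegrable hT.le] with x hx hi
  have h0 := integral_mul_test_eq_neg hT.le hk (fun s => hasDerivAt_test_time φ s x)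
    ((φ.contDiff.of_le (by simp)).comp (contDiff_id.prodMk contDiff_const))
    (φ.eq_zero_of_notMem_slab (by simp)) (φ.eq_zero_of_notMem_slab (by simp)) hi (f 0 x)
    (fun s => rfl)
  refine Eq.trans ?_ h0
  refine intervalIntegral.integral_congr_ae_restrict ?_
  rw [uIoc_of_le hT.le, ← Measure.restrict_congr_set Ioo_ae_eq_Ioc]
  filter_upwards [hx] with s hs
  rw [← hs]
  rfl

end TimeRegularity

/-! ### The energy equality -/

section Energy

theorem eLpNorm_two_sq_eq_ofReal {α F : Type*} {m : MeasurableSpace α} {μ : Measure α}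
    [NormedAddCommGroup F] {f : α → F} (hf : MemLp f 2 μ) :
    eLpNorm f 2 μ ^ 2 = ENNReal.ofReal (∫ x, ‖f x‖ ^ 2 ∂μ) := by
  rw [eLpNorm_two_sq, ofReal_integral_eq_lintegral_ofReal (hf.integrable_norm_pow two_ne_zero)
    (.of_forall fun x => by positivity)]
  refine lintegral_congr fun x => ?_
  rw [ENNReal.ofReal_pow (norm_nonneg _), ofReal_norm]

variable {T t : ℝ}

theorem integral_slab_eq_integral_time {W : ℝ × E3 → ℝ} (hW : Integrable W (slabMeasure t)) :
    ∫ z, W z ∂(slabMeasure t) = ∫ s in Ioo 0 t, ∫ x, W (s, x) := by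
  rw [slabMeasure_eq_prod] at hW ⊢
  exact integral_prod _ hW

theorem IsL2H1.ae_memLp {F : Type*} [NormedAddCommGroup F] [NormedSpace ℝ F] {f : ℝ → E3 → F}
    {Df : ℝ → E3 → E3 →L[ℝ] F} (h : IsL2H1 T f Df) :
    ∀ᵐ s ∂(volume.restrict (Ioo 0 T)), HasWeakFDeriv (f s) (Df s) ∧ MemLp (f s) 2 volume ∧
      MemLp (Df s) 2 volume := by
  have h1 := h.memLp
  have h2 := h.memLp_deriv
  rw [slabMeasure_eq_prod] at h1 h2
  filter_upwards [h.hasWeakFDeriv, h1.ae_prodMk_left, h2.ae_prodMk_left] with s a b c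
  exact ⟨a, b, c⟩

variable {ε : ℝ → ℝ} (S : StrongSolution T ε)

/-- The momentum equation tested with `u`, integrated over `(0,t) × ℝ³`. -/
theorem StrongSolution.integral_inner_dtu (ht : t ≤ T) :
    ∫ z, inner ℝ (S.dtu z.1 z.2) (S.u z.1 z.2) ∂(slabMeasure t)
      = ∫ z, (S.p z.1 z.2 * divOf (S.Du z.1 z.2) - frobeniusSq (S.Du z.1 z.2))
        ∂(slabMeasure t) := by
  have hmono := slabMeasure_mono ht
  have i1 := (integrable_inner_of_memLp S.u_time.memLp_deriv S.u_time.memLp).mono_measure hmono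
  have i2 := (S.p_time.memLp.integrable_fun_mul
    (memLp_divOf S.u_space.memLp_deriv)).mono_measure hmono
  have i3 := (integrable_frobeniusSq S.u_space.memLp_deriv).mono_measure hmono
  have i23 : Integrable (fun z : ℝ × E3 => S.p z.1 z.2 * divOf (S.Du z.1 z.2)
      - frobeniusSq (S.Du z.1 z.2)) (slabMeasure t) := i2.sub i3
  rw [integral_slab_eq_integral_time i1, integral_slab_eq_integral_time i23]
  refine setIntegral_congr_ae₀ measurableSet_Ioo.nullMeasurableSet ?_
  have hm := S.momentum
  rw [slabMeasure_eq_prod] at hm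
  have key : ∀ᵐ s ∂(volume.restrict (Ioo 0 T)),
      ∫ x, inner ℝ (S.dtu s x) (S.u s x)
        = ∫ x, (S.p s x * divOf (S.Du s x) - frobeniusSq (S.Du s x)) := by
    filter_upwards [S.u_space.ae_memLp, S.Du_space.ae_memLp, S.p_space.ae_memLp,
      Measure.ae_ae_of_ae_prod hm] with s ⟨hu, huL, hDuL⟩ ⟨hDu, _, hD2uL⟩ ⟨hp, hpL, hDpL⟩ hs
    rw [integral_inner_dtu_eq hu huL hDuL hDu hD2uL hp hpL hDpL hs,
      integral_sub (hpL.integrable_fun_mul (memLp_divOf hDuL)) (integrable_frobeniusSq hDuL)]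
  filter_upwards [(ae_restrict_iff' measurableSet_Ioo).1 key] with s hs hst
  exact hs ⟨hst.1, hst.2.trans_le ht⟩

theorem StrongSolution.integral_norm_sq_u_sub (hT : 0 < T) (ht : t ∈ Icc 0 T) :
    (∫ x, ‖S.u t x‖ ^ 2) - (∫ x, ‖S.u 0 x‖ ^ 2)
      = 2 * ∫ z, inner ℝ (S.dtu z.1 z.2) (S.u z.1 z.2) ∂(slabMeasure t) := by
  have h := fun i => (S.u_time.coord hT.le i).weighted_integral_sq_sub
    (k := fun _ => 1) contDiffOn_const ht hT
  have hsl : ∀ s ∈ Icc 0 T, ∫ x, ‖S.u s x‖ ^ 2 = ∑ i, ∫ x, S.u s x i * S.u s x i := by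
    intro s hs
    have hi := memLp_coord (S.u_time.memLp_slice s hs)
    rw [← integral_finsetSum _ fun i _ => (hi i).integrable_fun_mul (hi i)]
    refine integral_congr_ae (.of_forall fun x => ?_)
    dsimp only
    rw [EuclideanSpace.real_norm_sq_eq]
    simp only [sq]
  rw [hsl t ht, hsl 0 ⟨le_rfl, hT.le⟩, ← Finset.sum_sub_distrib, ← integral_const_mul]
  have h2 : ∀ z : ℝ × E3, 2 * inner ℝ (S.dtu z.1 z.2) (S.u z.1 z.2)
      = ∑ i, (derivWithin (fun _ => (1 : ℝ)) (Icc 0 T) z.1 * (S.u z.1 z.2 i * S.u z.1 z.2 i)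
        + 2 * (1 * (S.u z.1 z.2 i * S.dtu z.1 z.2 i))) := by
    intro z
    rw [inner_E3, Finset.mul_sum]
    refine Finset.sum_congr rfl fun i _ => ?_
    simp only [derivWithin_fun_const, Pi.zero_apply]
    ring
  simp_rw [h2]
  rw [integral_finsetSum _ fun i _ => (h i).1]
  refine Finset.sum_congr rfl fun i _ => ?_
  rw [← (h i).2, one_mul, one_mul]

/-- The continuity equation tested with `p`. The term `-½ ε' p` is what makes the weight `ε` in
`ε ‖p‖²` differentiate correctly. -/
theorem StrongSolution.weighted_integral_sq_p_sub (hε : ContDiffOn ℝ 1 ε (Icc 0 T)) (hT : 0 < T)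
    (ht : t ∈ Icc 0 T) :
    ε t * (∫ x, S.p t x * S.p t x) - ε 0 * (∫ x, S.p 0 x * S.p 0 x)
      = - 2 * ∫ z, S.p z.1 z.2 * divOf (S.Du z.1 z.2) ∂(slabMeasure t) := by
  rw [(S.p_time.weighted_integral_sq_sub hε ht hT).2, ← integral_const_mul]
  refine integral_congr_ae ?_
  filter_upwards [S.continuity.filter_mono (ae_mono (slabMeasure_mono ht.2))] with z hz
  linear_combination (2 * S.p z.1 z.2) * hz

/-- The energy equality. -/
theorem StrongSolution.energy_eq (hε : ContDiffOn ℝ 1 ε (Icc 0 T)) (hT : 0 < T)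
    (ht : t ∈ Icc 0 T) :
    (∫ x, ‖S.u t x‖ ^ 2) + ε t * (∫ x, S.p t x * S.p t x)
        + 2 * ∫ z, frobeniusSq (S.Du z.1 z.2) ∂(slabMeasure t)
      = (∫ x, ‖S.u 0 x‖ ^ 2) + ε 0 * (∫ x, S.p 0 x * S.p 0 x) := by
  have h1 := S.integral_norm_sq_u_sub hT ht
  have h2 := S.weighted_integral_sq_p_sub hε hT ht
  have h3 := S.integral_inner_dtu ht.2
  have hmono := slabMeasure_mono ht.2
  rw [integral_sub ((S.p_time.memLp.integrable_fun_mul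
    (memLp_divOf S.u_space.memLp_deriv)).mono_measure hmono)
    ((integrable_frobeniusSq S.u_space.memLp_deriv).mono_measure hmono)] at h3
  linarith

/-- Twice the initial energy. -/
noncomputable def StrongSolution.initialEnergy : ℝ≥0∞ :=
  eLpNorm (S.u 0) 2 volume ^ 2 + eLpNorm (fun x => √(ε 0) * S.p 0 x) 2 volume ^ 2

theorem StrongSolution.eLpNorm_sqrt_mul_p_sq (hε : ∀ s ∈ Icc 0 T, 0 < ε s) (ht : t ∈ Icc 0 T) :
    eLpNorm (fun x => √(ε t) * S.p t x) 2 volume ^ 2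
      = ENNReal.ofReal (ε t * ∫ x, S.p t x * S.p t x) := by
  rw [eLpNorm_two_sq_eq_ofReal ((S.p_time.memLp_slice t ht).const_mul _), ← integral_const_mul]
  congr 1
  refine integral_congr_ae (.of_forall fun x => ?_)
  dsimp only
  rw [Real.norm_eq_abs, sq_abs, mul_pow, Real.sq_sqrt (hε t ht).le, sq]

theorem StrongSolution.energy_bounds (hε : ContDiffOn ℝ 1 ε (Icc 0 T))
    (hε0 : ∀ s ∈ Icc 0 T, 0 < ε s) (hT : 0 < T) (ht : t ∈ Icc 0 T) :
    eLpNorm (S.u t) 2 volume ^ 2 ≤ S.initialEnergy ∧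
    eLpNorm (fun x => √(ε t) * S.p t x) 2 volume ^ 2 ≤ S.initialEnergy ∧
    eLpNorm (fun z : ℝ × E3 => S.Du z.1 z.2) 2 (slabMeasure t) ^ 2 ≤ S.initialEnergy := by
  have h0 : (0 : ℝ) ∈ Icc 0 T := ⟨le_rfl, hT.le⟩
  have hu0 : ∀ s, 0 ≤ ∫ x, ‖S.u s x‖ ^ 2 := fun s => integral_nonneg fun x => by positivity
  have hp0 : ∀ s ∈ Icc 0 T, 0 ≤ ε s * ∫ x, S.p s x * S.p s x := fun s hs =>
    mul_nonneg (hε0 s hs).le (integral_nonneg fun x => mul_self_nonneg _)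
  have hD0 : 0 ≤ ∫ z, frobeniusSq (S.Du z.1 z.2) ∂(slabMeasure t) :=
    integral_nonneg fun z => frobeniusSq_nonneg _
  have hE := S.energy_eq hε hT ht
  have hDL := S.u_space.memLp_deriv.mono_measure (slabMeasure_mono ht.2)
  -- The operator norm is at most the Frobenius norm, which is the one in the energy equality.
  have hD : ∫ z, ‖S.Du z.1 z.2‖ ^ 2 ∂(slabMeasure t)
      ≤ ∫ z, frobeniusSq (S.Du z.1 z.2) ∂(slabMeasure t) :=
    integral_mono (hDL.integrable_norm_pow two_ne_zero) (integrable_frobeniusSq hDL)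
      fun z => norm_sq_le_frobeniusSq _
  have hut := hu0 t
  have hpt := hp0 t ht
  rw [initialEnergy, S.eLpNorm_sqrt_mul_p_sq hε0 h0, S.eLpNorm_sqrt_mul_p_sq hε0 ht,
    eLpNorm_two_sq_eq_ofReal (S.u_time.memLp_slice 0 h0),
    eLpNorm_two_sq_eq_ofReal (S.u_time.memLp_slice t ht), eLpNorm_two_sq_eq_ofReal hDL,
    ← ENNReal.ofReal_add (hu0 0) (hp0 0 h0)]
  refine ⟨ENNReal.ofReal_le_ofReal ?_, ENNReal.ofReal_le_ofReal ?_, ENNReal.ofReal_le_ofReal ?_⟩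
    <;> linarith

end Energy

/-! ### Mixed norms, and compactness in `H⁻¹` -/

section MixedNorm

variable {T : ℝ} {F G : Type*} [NormedAddCommGroup F] [NormedAddCommGroup G]

theorem mixedNorm_top_le {r C : ℝ≥0∞} {f : ℝ → E3 → F}
    (h : ∀ t ∈ Ioo 0 T, eLpNorm (f t) r volume ≤ C) : mixedNorm T ∞ r f ≤ C := by
  rw [mixedNorm, eLpNorm_exponent_top]
  refine essSup_le_of_ae_le C ?_
  filter_upwards [ae_restrict_mem measurableSet_Ioo] with t ht
  exact h t ht

theorem lintegral_eLpNorm_two_sq {D : ℝ → E3 → G}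
    (hD : AEStronglyMeasurable (fun z : ℝ × E3 => D z.1 z.2) (slabMeasure T)) :
    ∫⁻ t in Ioo 0 T, eLpNorm (D t) 2 volume ^ 2
      = eLpNorm (fun z : ℝ × E3 => D z.1 z.2) 2 (slabMeasure T) ^ 2 := by
  simp_rw [eLpNorm_two_sq]
  rw [slabMeasure_eq_prod] at hD ⊢
  exact (lintegral_prod _ (hD.enorm.pow_const 2)).symm

theorem mixedNorm_two_le {r : ℝ≥0∞} {K : ℝ≥0} {f : ℝ → E3 → F} {D : ℝ → E3 → G}
    (hD : AEStronglyMeasurable (fun z : ℝ × E3 => D z.1 z.2) (slabMeasure T))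
    (h : ∀ᵐ t ∂(volume.restrict (Ioo 0 T)),
      eLpNorm (f t) r volume ≤ K * eLpNorm (D t) 2 volume) :
    mixedNorm T 2 r f ≤ K * eLpNorm (fun z : ℝ × E3 => D z.1 z.2) 2 (slabMeasure T) := by
  rw [← ENNReal.pow_le_pow_left_iff two_ne_zero, mul_pow, ← lintegral_eLpNorm_two_sq hD,
    ← lintegral_const_mul' _ _ (by simp), mixedNorm, eLpNorm_two_sq]
  refine lintegral_mono_ae (h.mono fun t ht => ?_)
  rw [← mul_pow]
  exact pow_le_pow_left' ht 2

theorem mixedNorm_one_le {r : ℝ≥0∞} {K : ℝ≥0} {f : ℝ → E3 → F} {D : ℝ → E3 → G}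
    (hD : AEStronglyMeasurable (fun z : ℝ × E3 => D z.1 z.2) (slabMeasure T))
    (h : ∀ᵐ t ∂(volume.restrict (Ioo 0 T)),
      eLpNorm (f t) r volume ≤ K * eLpNorm (D t) 2 volume ^ 2) :
    mixedNorm T 1 r f ≤ K * eLpNorm (fun z : ℝ × E3 => D z.1 z.2) 2 (slabMeasure T) ^ 2 := by
  rw [← lintegral_eLpNorm_two_sq hD, ← lintegral_const_mul' _ _ (by simp), mixedNorm,
    eLpNorm_one_eq_lintegral_enorm]
  exact lintegral_mono_ae h

end MixedNorm

section Convection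

theorem holderTriple_two_six : ENNReal.HolderTriple 2 6 (3 / 2) := by
  refine ⟨?_⟩
  rw [← ENNReal.toReal_eq_toReal_iff' (by simp) (ENNReal.inv_ne_top.2 (by simp)),
    ENNReal.toReal_add (by simp) (by simp)]
  simp
  norm_num

theorem eLpNorm_convection_le {q r : ℝ≥0∞} [ENNReal.HolderTriple 2 q r] {A : E3 → E3 →L[ℝ] E3}
    {w g : E3 → E3} (hA : AEStronglyMeasurable A volume) (hw : AEStronglyMeasurable w volume)
    (hg : ∀ x, ‖g x‖ ≤ 3 * (‖A x‖ * ‖w x‖)) :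
    eLpNorm g r volume ≤ 3 * (eLpNorm A 2 volume * eLpNorm w q volume) := by
  have h1 : eLpNorm g r volume ≤ ENNReal.ofReal 3 *
      eLpNorm ((fun x => ‖A x‖) * fun x => ‖w x‖) r volume := by
    refine eLpNorm_le_mul_eLpNorm_of_ae_le_mul (.of_forall fun x => ?_) r
    simpa using hg x
  refine h1.trans ?_
  rw [ENNReal.ofReal_ofNat]
  gcongr
  refine (eLpNorm_mul_le_mul_eLpNorm (p := 2) (q := q) hA.norm hw.norm).trans ?_
  rw [eLpNorm_norm, eLpNorm_norm]

variable {T : ℝ} {ε : ℝ → ℝ} (S : StrongSolution T ε)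

theorem StrongSolution.ae_eLpNorm_six_le : ∀ᵐ t ∂(volume.restrict (Ioo 0 T)),
    eLpNorm (S.u t) 6 volume ≤ sobolevConst * eLpNorm (S.Du t) 2 volume :=
  S.u_space.ae_memLp.mono fun _ h => h.1.eLpNorm_six_le h.2.1 h.2.2

/-- The bound common to `(u·∇)u` and `(∇·u)u`; the constant `3` comes from `|∇·u| ≤ 3 ‖∇u‖`. In time,
`L² L¹` uses `L^∞ L²` for `u`, and `L¹ L^{3/2}` uses the Sobolev inequality at almost every time. -/
theorem StrongSolution.mixedNorm_convection_le {g : ℝ → E3 → E3} {C : ℝ≥0}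
    (hg : ∀ t x, ‖g t x‖ ≤ 3 * (‖S.Du t x‖ * ‖S.u t x‖))
    (hu : ∀ t ∈ Icc 0 T, eLpNorm (S.u t) 2 volume ≤ C)
    (hDu : eLpNorm (fun z : ℝ × E3 => S.Du z.1 z.2) 2 (slabMeasure T) ≤ C) :
    mixedNorm T 2 1 g ≤ (3 * C * C : ℝ≥0) ∧
      mixedNorm T 1 (3 / 2) g ≤ (3 * sobolevConst * C ^ 2 : ℝ≥0) := by
  have hDm := S.u_space.memLp_deriv.1
  have := holderTriple_two_six
  constructor
  · refine (mixedNorm_two_le (K := 3 * C) hDm ?_).trans ?_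
    · filter_upwards [S.u_space.ae_memLp, ae_restrict_mem measurableSet_Ioo] with t h ht
      refine (eLpNorm_convection_le (q := 2) h.2.2.1 h.2.1.1 (hg t)).trans ?_
      push_cast
      rw [mul_comm (eLpNorm (S.Du t) 2 volume), ← mul_assoc]
      gcongr
      exact hu t (Ioo_subset_Icc_self ht)
    · push_cast
      gcongr
  · refine (mixedNorm_one_le (K := 3 * sobolevConst) hDm ?_).trans ?_
    · filter_upwards [S.u_space.ae_memLp, S.ae_eLpNorm_six_le] with t h h6
      refine (eLpNorm_convection_le (q := 6) h.2.2.1 h.2.1.1 (hg t)).trans ?_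
      push_cast
      rw [mul_assoc]
      refine mul_le_mul_right ?_ _
      refine (mul_le_mul_right h6 _).trans_eq ?_
      ring
    · push_cast
      gcongr

theorem StrongSolution.norm_convection_le (t : ℝ) (x : E3) :
    ‖S.Du t x (S.u t x)‖ ≤ 3 * (‖S.Du t x‖ * ‖S.u t x‖) := by
  have h1 := (S.Du t x).le_opNorm (S.u t x)
  have h2 : 0 ≤ ‖S.Du t x‖ * ‖S.u t x‖ := by positivity
  linarith

theorem StrongSolution.norm_divOf_smul_le (t : ℝ) (x : E3) :
    ‖divOf (S.Du t x) • S.u t x‖ ≤ 3 * (‖S.Du t x‖ * ‖S.u t x‖) := by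
  rw [norm_smul, ← mul_assoc]
  gcongr
  exact abs_divOf_le _

theorem StrongSolution.aestronglyMeasurable_convection :
    AEStronglyMeasurable (fun z : ℝ × E3 => S.Du z.1 z.2 (S.u z.1 z.2)) (slabMeasure T) :=
  (ContinuousLinearMap.id ℝ (E3 →L[ℝ] E3)).aestronglyMeasurable_comp₂ S.u_space.memLp_deriv.1
    S.u_space.memLp.1

theorem StrongSolution.aestronglyMeasurable_divOf_smul :
    AEStronglyMeasurable (fun z : ℝ × E3 => divOf (S.Du z.1 z.2) • S.u z.1 z.2) (slabMeasure T) :=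
  (memLp_divOf S.u_space.memLp_deriv).1.smul S.u_space.memLp.1

end Convection

section NegativeSobolev

variable {T : ℝ}

theorem tendsto_neg_innerSL_comp_add {H V : Type*} [NormedAddCommGroup H] [InnerProductSpace ℝ H]
    [NormedAddCommGroup V] [NormedSpace ℝ V] (P Q : V →L[ℝ] H) {a b : ℕ → H}
    (ha : Tendsto a atTop (𝓝 0)) (hb : Tendsto b atTop (𝓝 0)) :
    Tendsto (fun n => -((innerSL ℝ (a n)).comp P + (innerSL ℝ (b n)).comp Q)) atTop
      (𝓝 (0 : StrongDual ℝ V)) := by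
  have hc : ∀ {c : ℕ → H} (R : V →L[ℝ] H), Tendsto c atTop (𝓝 0) →
      Tendsto (fun n => (innerSL ℝ (c n)).comp R) atTop (𝓝 (0 : StrongDual ℝ V)) := by
    intro c R hc
    refine squeeze_zero_norm (a := fun n => ‖c n‖ * ‖R‖) (fun n => ?_) ?_
    · refine (ContinuousLinearMap.opNorm_comp_le _ _).trans_eq ?_
      rw [innerSL_apply_norm]
    · simpa using (hc.norm).mul_const ‖R‖
  simpa using ((hc P ha).add (hc Q hb)).neg

theorem isCompact_closure_range_neg_innerSL_comp_add {H V : Type*} [NormedAddCommGroup H]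
    [InnerProductSpace ℝ H] [NormedAddCommGroup V] [NormedSpace ℝ V] (P Q : V →L[ℝ] H)
    {a b : ℕ → H} (ha : Tendsto a atTop (𝓝 0)) (hb : Tendsto b atTop (𝓝 0)) :
    IsCompact (closure (range fun n =>
      (-((innerSL ℝ (a n)).comp P + (innerSL ℝ (b n)).comp Q) : StrongDual ℝ V))) :=
  (tendsto_neg_innerSL_comp_add P Q ha hb).isCompact_insert_range.closure_of_subset
    (subset_insert _ _)

/-- The functional `φ ↦ -∫ (a ∂ₜφ + b φ)` on `H¹₀`, that is, the distribution `∂ₜa - b`. -/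
noncomputable def timeDerivFunctional (a b : Lp ℝ 2 (slabMeasure T)) : HNeg1 T :=
  -((innerSL ℝ a).comp ((((ContinuousLinearMap.apply ℝ ℝ ((1, 0) : ℝ × E3)).compLpL 2
      (slabMeasure T)).comp (ContinuousLinearMap.snd ℝ _ _)).comp (H10 T).subtypeL)
    + (innerSL ℝ b).comp ((ContinuousLinearMap.fst ℝ _ _).comp (H10 T).subtypeL))

theorem isCompact_closure_range_timeDerivFunctional {a b : ℕ → Lp ℝ 2 (slabMeasure T)}
    (ha : Tendsto a atTop (𝓝 0)) (hb : Tendsto b atTop (𝓝 0)) :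
    IsCompact (closure (range fun n => timeDerivFunctional (a n) (b n))) :=
  isCompact_closure_range_neg_innerSL_comp_add _ _ ha hb

theorem timeDerivFunctional_ofTest {a b : ℝ × E3 → ℝ} (ha : MemLp a 2 (slabMeasure T))
    (hb : MemLp b 2 (slabMeasure T)) (φ : 𝓓(slab T, ℝ)) :
    timeDerivFunctional (ha.toLp a) (hb.toLp b) (H10.ofTest φ)
      = - ((∫ z, a z * fderiv ℝ φ z (1, 0) ∂(slabMeasure T))
        + ∫ z, b z * φ z ∂(slabMeasure T)) := by
  have h1 : inner ℝ (ha.toLp a) ((ContinuousLinearMap.apply ℝ ℝ ((1, 0) : ℝ × E3)).compLp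
      (φ.memLp_fderiv_slab.toLp (fderiv ℝ φ)))
      = ∫ z, a z * fderiv ℝ φ z (1, 0) ∂(slabMeasure T) := by
    rw [L2.inner_def]
    refine integral_congr_ae ?_
    filter_upwards [ha.coeFn_toLp, φ.memLp_fderiv_slab.coeFn_toLp,
      (ContinuousLinearMap.apply ℝ ℝ ((1, 0) : ℝ × E3)).coeFn_compLp
        (φ.memLp_fderiv_slab.toLp (fderiv ℝ φ))] with z e1 e2 e3
    rw [e1, e3, e2]
    exact mul_comm _ _
  have h2 : inner ℝ (hb.toLp b) (φ.memLp_slab.toLp φ) = ∫ z, b z * φ z ∂(slabMeasure T) := by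
    rw [L2.inner_def]
    refine integral_congr_ae ?_
    filter_upwards [hb.coeFn_toLp, φ.memLp_slab.coeFn_toLp] with z e1 e2
    rw [e1, e2]
    exact mul_comm _ _
  rw [← h1, ← h2]
  rfl

theorem tendsto_eLpNorm_slab_of_small {f q : ℕ → ℝ × E3 → ℝ} {M : ℝ≥0}
    (hq : ∀ n, eLpNorm (q n) 2 (slabMeasure T) ≤ M)
    (h : ∀ δ > (0 : ℝ), ∀ᶠ n in atTop, ∀ z : ℝ × E3, z.1 ∈ Ioo 0 T → ‖f n z‖ ≤ δ * ‖q n z‖) :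
    Tendsto (fun n => eLpNorm (f n) 2 (slabMeasure T)) atTop (𝓝 0) := by
  rw [ENNReal.tendsto_nhds_zero]
  intro η hη
  obtain ⟨δ, hδ, hδη⟩ : ∃ δ : ℝ, 0 < δ ∧ ENNReal.ofReal δ * M ≤ η := by
    have ht : Tendsto (fun δ : ℝ => ENNReal.ofReal δ * M) (𝓝[>] 0) (𝓝 0) := by
      have : Tendsto (fun δ : ℝ => ENNReal.ofReal δ * M) (𝓝 0) (𝓝 (ENNReal.ofReal 0 * M)) :=
        ENNReal.Tendsto.mul_const (ENNReal.tendsto_ofReal tendsto_id) (Or.inr (by simp))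
      simpa using this.mono_left nhdsWithin_le_nhds
    obtain ⟨δ, h1, h2⟩ :=
      (((ENNReal.tendsto_nhds_zero.1 ht) η hη).and self_mem_nhdsWithin).exists
    exact ⟨δ, h2, h1⟩
  filter_upwards [h δ hδ] with n hn
  refine le_trans ?_ hδη
  refine (eLpNorm_le_mul_eLpNorm_of_ae_le_mul (ae_slab_mem.mono fun z hz => hn z hz) 2).trans ?_
  gcongr
  exact hq n

theorem tendsto_toLp_zero {f : ℕ → ℝ × E3 → ℝ} (hf : ∀ n, MemLp (f n) 2 (slabMeasure T))
    (h : Tendsto (fun n => eLpNorm (f n) 2 (slabMeasure T)) atTop (𝓝 0)) :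
    Tendsto (fun n => (hf n).toLp (f n)) atTop (𝓝 0) := by
  rw [tendsto_zero_iff_norm_tendsto_zero]
  simp_rw [Lp.norm_toLp]
  exact (ENNReal.tendsto_toReal ENNReal.zero_ne_top).comp h

/-- If `kₙfₙ` and `kₙ'fₙ` tend to zero in `L²`, then `kₙ ∂ₜfₙ = ∂ₜ(kₙfₙ) - kₙ'fₙ` tends to zero
in `H⁻¹`. -/
theorem relativelyCompactInHNeg1_mul_dt (hT : 0 < T) {k : ℕ → ℝ → ℝ} {f dtf : ℕ → ℝ → E3 → ℝ}
    (hk : ∀ n, ContDiffOn ℝ 1 (k n) (Icc 0 T)) (hf : ∀ n, IsH1L2 T (f n) (dtf n))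
    (h1 : Tendsto (fun n => eLpNorm (fun z : ℝ × E3 => k n z.1 * f n z.1 z.2) 2 (slabMeasure T))
      atTop (𝓝 0))
    (h2 : Tendsto (fun n => eLpNorm (fun z : ℝ × E3 => derivWithin (k n) (Icc 0 T) z.1 *
      f n z.1 z.2) 2 (slabMeasure T)) atTop (𝓝 0)) :
    RelativelyCompactInHNeg1 T (fun n t x => k n t * dtf n t x) := by
  have m1 : ∀ n, MemLp (fun z : ℝ × E3 => k n z.1 * f n z.1 z.2) 2 (slabMeasure T) := fun n =>
    (hf n).memLp.time_mul (hk n).continuousOn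
  have m2 : ∀ n, MemLp (fun z : ℝ × E3 => derivWithin (k n) (Icc 0 T) z.1 * f n z.1 z.2) 2
      (slabMeasure T) := fun n =>
    (hf n).memLp.time_mul ((hk n).continuousOn_derivWithin (uniqueDiffOn_Icc hT) le_rfl)
  refine ⟨fun n => timeDerivFunctional ((m1 n).toLp _) ((m2 n).toLp _), fun n => ⟨?_, fun φ => ?_⟩,
    ?_⟩
  · have hm := (hf n).memLp_deriv.time_mul (hk n).continuousOn
    have : IsLocallyFiniteMeasure (slabMeasure T) := by unfold slabMeasure; infer_instance
    exact locallyIntegrableOn_of_locallyIntegrable_restrict (hm.locallyIntegrable one_le_two)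
  · rw [timeDerivFunctional_ofTest, (hf n).integral_mul_test (hk n) hT φ]
  · exact isCompact_closure_range_timeDerivFunctional (tendsto_toLp_zero m1 h1)
      (tendsto_toLp_zero m2 h2)

end NegativeSobolev

section UniformBounds

theorem exists_nnreal_bound_of_tendsto_zero {a : ℕ → ℝ≥0∞} (ha : ∀ n, a n ≠ ∞)
    (h : Tendsto a atTop (𝓝 0)) : ∃ C : ℝ≥0, ∀ n, a n ≤ C := by
  have h' := (ENNReal.tendsto_toNNReal ENNReal.zero_ne_top).comp h
  obtain ⟨C, hC⟩ := h'.bddAbove_range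
  refine ⟨C, fun n => ?_⟩
  rw [← ENNReal.coe_toNNReal (ha n)]
  exact ENNReal.coe_le_coe.2 (hC ⟨n, rfl⟩)

variable {T : ℝ} {ε : ℕ → ℝ → ℝ}

theorem exists_initialEnergy_bound (hT : 0 ≤ T) (sol : ∀ n, StrongSolution T (ε n)) {u₀ : E3 → E3}
    (hu₀ : MemLp u₀ 2 volume)
    (hu_init : Tendsto (fun n => eLpNorm (fun x => (sol n).u 0 x - u₀ x) 2 volume) atTop (𝓝 0))
    (hp_init : Tendsto (fun n => eLpNorm (fun x => √(ε n 0) * (sol n).p 0 x) 2 volume)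
      atTop (𝓝 0)) : ∃ C : ℝ≥0, ∀ n, (sol n).initialEnergy ≤ (C : ℝ≥0∞) ^ 2 := by
  have h0 : (0 : ℝ) ∈ Icc 0 T := ⟨le_rfl, hT⟩
  obtain ⟨C₁, hC₁⟩ := exists_nnreal_bound_of_tendsto_zero
    (fun n => (((sol n).u_time.memLp_slice 0 h0).sub hu₀).2.ne) hu_init
  obtain ⟨C₂, hC₂⟩ := exists_nnreal_bound_of_tendsto_zero
    (fun n => (((sol n).p_time.memLp_slice 0 h0).const_mul _).2.ne) hp_init
  refine ⟨C₁ + (eLpNorm u₀ 2 volume).toNNReal + C₂, fun n => ?_⟩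
  push_cast
  rw [ENNReal.coe_toNNReal hu₀.2.ne]
  have hu : eLpNorm ((sol n).u 0) 2 volume ≤ C₁ + eLpNorm u₀ 2 volume :=
    (eLpNorm_le_eLpNorm_sub_add ((sol n).u_time.memLp_slice 0 h0).1 hu₀.1 one_le_two).trans
      (add_le_add_left (hC₁ n) _)
  calc (sol n).initialEnergy ≤ (C₁ + eLpNorm u₀ 2 volume) ^ 2 + (C₂ : ℝ≥0∞) ^ 2 :=
        add_le_add (pow_le_pow_left' hu 2) (pow_le_pow_left' (hC₂ n) 2)
    _ ≤ (C₁ + eLpNorm u₀ 2 volume + C₂) ^ 2 := by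
        rw [add_sq (_ + _)]
        gcongr
        exact le_self_add

theorem tendstoUniformlyOn_zero_iff_eventually {g : ℕ → ℝ → ℝ} {s : Set ℝ} :
    TendstoUniformlyOn g 0 atTop s ↔ ∀ δ > 0, ∀ᶠ n in atTop, ∀ t ∈ s, |g n t| < δ := by
  simp [Metric.tendstoUniformlyOn_iff, dist_eq_norm]

end UniformBounds

/-! ### The uniform bounds -/

theorem StrongSolution.eLpNorm_sqrt_mul_p_slab_le {T : ℝ} {ε : ℝ → ℝ} (S : StrongSolution T ε)
    (hε : ContDiffOn ℝ 1 ε (Icc 0 T)) {C : ℝ≥0}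
    (h : ∀ t ∈ Icc 0 T, eLpNorm (fun x => √(ε t) * S.p t x) 2 volume ≤ C) :
    eLpNorm (fun z : ℝ × E3 => √(ε z.1) * S.p z.1 z.2) 2 (slabMeasure T)
      ≤ (C * NNReal.sqrt T.toNNReal : ℝ≥0) := by
  have hm := (S.p_time.memLp.time_mul hε.continuousOn.sqrt).1
  rw [← ENNReal.pow_le_pow_left_iff two_ne_zero,
    ← lintegral_eLpNorm_two_sq (D := fun t x => √(ε t) * S.p t x) hm]
  calc ∫⁻ t in Ioo 0 T, eLpNorm (fun x => √(ε t) * S.p t x) 2 volume ^ 2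
      ≤ ∫⁻ _ in Ioo 0 T, (C : ℝ≥0∞) ^ 2 :=
        setLIntegral_mono' measurableSet_Ioo fun t ht =>
          pow_le_pow_left' (h t (Ioo_subset_Icc_self ht)) 2
    _ = (C * NNReal.sqrt T.toNNReal : ℝ≥0) ^ 2 := by
        rw [setLIntegral_const, Real.volume_Ioo, sub_zero, ENNReal.coe_mul, mul_pow,
          ← ENNReal.coe_pow (NNReal.sqrt _), NNReal.sq_sqrt]
        rfl

theorem corollary3p3 (T : ℝ) (hT : 0 < T)
    -- the relaxation parameters `εₙ(t)`, which tend to zero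
    (ε : ℕ → ℝ → ℝ)
    (hε_smooth : ∀ n, ContDiffOn ℝ 1 (ε n) (Icc 0 T))
    (hε_pos : ∀ n, ∀ t ∈ Icc 0 T, 0 < ε n t)
    (hε_lim : TendstoUniformlyOn ε 0 atTop (Icc 0 T))
    -- strong solutions `(uₙ, pₙ)` with well-prepared initial data
    (sol : ∀ n, StrongSolution T (ε n))
    (u₀ : E3 → E3) (hu₀ : MemLp u₀ 2 volume)
    (hu_init : Tendsto (fun n => eLpNorm (fun x => (sol n).u 0 x - u₀ x) 2 volume) atTop (𝓝 0))
    (hp_init : Tendsto (fun n => eLpNorm (fun x => √(ε n 0) * (sol n).p 0 x) 2 volume)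
      atTop (𝓝 0)) :
    -- `√ε p` is bounded in `L^∞ L²`
    BoundedInLqLr T ∞ 2 (fun n t x => √(ε n t) * (sol n).p t x) ∧
    -- `ε pₜ` is relatively compact in `H⁻¹`, when `εₜ = o(ε)`
    (TendstoUniformlyOn (fun n t => derivWithin (ε n) (Icc 0 T) t / ε n t) 0 atTop (Icc 0 T) →
      RelativelyCompactInHNeg1 T (fun n t x => ε n t * (sol n).dtp t x)) ∧
    -- `∇u` is bounded in `L²`
    BoundedInL2 T (fun n => (sol n).Du) ∧
    -- `u` is bounded in `L^∞ L² ∩ L² L⁶`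
    (BoundedInLqLr T ∞ 2 (fun n => (sol n).u) ∧
      BoundedInLqLr T 2 6 (fun n => (sol n).u)) ∧
    -- `(u·∇)u` is bounded in `L² L¹ ∩ L¹ L^{3/2}`
    (BoundedInLqLr T 2 1 (fun n t x => (sol n).Du t x ((sol n).u t x)) ∧
      BoundedInLqLr T 1 (3 / 2) (fun n t x => (sol n).Du t x ((sol n).u t x))) ∧
    -- `(∇·u)u` is bounded in `L² L¹ ∩ L¹ L^{3/2}`
    (BoundedInLqLr T 2 1 (fun n t x => divOf ((sol n).Du t x) • (sol n).u t x) ∧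
      BoundedInLqLr T 1 (3 / 2) (fun n t x => divOf ((sol n).Du t x) • (sol n).u t x)) := by
  obtain ⟨C, hC⟩ := exists_initialEnergy_bound hT.le sol hu₀ hu_init hp_init
  have hsq : ∀ {a b : ℝ≥0∞}, a ^ 2 ≤ b → b ≤ (C : ℝ≥0∞) ^ 2 → a ≤ C := fun h1 h2 =>
    (ENNReal.pow_le_pow_left_iff two_ne_zero).1 (h1.trans h2)
  have hE := fun n t (ht : t ∈ Icc 0 T) => (sol n).energy_bounds (hε_smooth n) (hε_pos n) hT ht
  have hu : ∀ n, ∀ t ∈ Icc 0 T, eLpNorm ((sol n).u t) 2 volume ≤ C := fun n t ht =>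
    hsq (hE n t ht).1 (hC n)
  have hp : ∀ n, ∀ t ∈ Icc 0 T, eLpNorm (fun x => √(ε n t) * (sol n).p t x) 2 volume ≤ C :=
    fun n t ht => hsq (hE n t ht).2.1 (hC n)
  have hDu : ∀ n, eLpNorm (fun z : ℝ × E3 => (sol n).Du z.1 z.2) 2 (slabMeasure T) ≤ C :=
    fun n => hsq (hE n T ⟨hT.le, le_rfl⟩).2.2 (hC n)
  have hum := fun n => (sol n).u_space.memLp.1
  have hDum := fun n => (sol n).u_space.memLp_deriv.1
  have hconv := fun n => (sol n).mixedNorm_convection_le (sol n).norm_convection_le (hu n) (hDu n)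
  have hdiv := fun n => (sol n).mixedNorm_convection_le (sol n).norm_divOf_smul_le (hu n) (hDu n)
  have hconvm := fun n => (sol n).aestronglyMeasurable_convection
  have hdivm := fun n => (sol n).aestronglyMeasurable_divOf_smul
  refine ⟨⟨fun n => ((sol n).p_time.memLp.time_mul (hε_smooth n).continuousOn.sqrt).1, C, fun n =>
      mixedNorm_top_le fun t ht => hp n t (Ioo_subset_Icc_self ht)⟩, fun hε' => ?_,
    ⟨hDum, C, hDu⟩,
    ⟨⟨hum, C, fun n => mixedNorm_top_le fun t ht => hu n t (Ioo_subset_Icc_self ht)⟩,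
      ⟨hum, sobolevConst * C, fun n => ?_⟩⟩,
    ⟨⟨hconvm, _, fun n => (hconv n).1⟩, ⟨hconvm, _, fun n => (hconv n).2⟩⟩,
    ⟨⟨hdivm, _, fun n => (hdiv n).1⟩, ⟨hdivm, _, fun n => (hdiv n).2⟩⟩⟩
  · rw [tendstoUniformlyOn_zero_iff_eventually] at hε_lim hε'
    have hq := fun n => (sol n).eLpNorm_sqrt_mul_p_slab_le (hε_smooth n) (hp n)
    have hsqrt : ∀ δ > 0, ∀ᶠ n in atTop, ∀ t ∈ Icc 0 T, √(ε n t) ≤ δ := by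
      intro δ hδ
      filter_upwards [hε_lim (δ ^ 2) (by positivity)] with n hn t ht
      exact Real.sqrt_le_iff.2 ⟨hδ.le, ((le_abs_self _).trans (hn t ht).le)⟩
    refine relativelyCompactInHNeg1_mul_dt hT hε_smooth (fun n => (sol n).p_time)
      (tendsto_eLpNorm_slab_of_small hq fun δ hδ => ?_)
      (tendsto_eLpNorm_slab_of_small hq fun δ hδ => ?_)
    · -- `|ε p| = √ε |√ε p|`
      filter_upwards [hsqrt δ hδ] with n hn z hz
      have hz' := Ioo_subset_Icc_self hz
      have hd : ε n z.1 * (sol n).p z.1 z.2 = √(ε n z.1) * (√(ε n z.1) * (sol n).p z.1 z.2) := by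
        rw [← mul_assoc, Real.mul_self_sqrt (hε_pos n _ hz').le]
      rw [hd, norm_mul, Real.norm_of_nonneg (Real.sqrt_nonneg _)]
      gcongr
      exact hn _ hz'
    · -- `|ε' p| = |ε' / ε| √ε |√ε p|`
      filter_upwards [hsqrt 1 one_pos, hε' δ hδ] with n hn hn' z hz
      have hz' := Ioo_subset_Icc_self hz
      have hpos := hε_pos n _ hz'
      have hd : derivWithin (ε n) (Icc 0 T) z.1 * (sol n).p z.1 z.2
          = derivWithin (ε n) (Icc 0 T) z.1 / ε n z.1 * √(ε n z.1)
            * (√(ε n z.1) * (sol n).p z.1 z.2) := by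
        rw [mul_assoc (_ / _), ← mul_assoc √_, Real.mul_self_sqrt hpos.le]
        field_simp
      rw [hd, norm_mul, norm_mul, Real.norm_of_nonneg (Real.sqrt_nonneg _), Real.norm_eq_abs]
      gcongr
      calc _ ≤ δ * 1 := mul_le_mul (hn' _ hz').le (hn _ hz') (Real.sqrt_nonneg _) hδ.le
        _ = δ := mul_one δ
  · refine (mixedNorm_two_le (hDum n) (sol n).ae_eLpNorm_six_le).trans ?_
    rw [ENNReal.coe_mul]
    gcongr
    exact hDu n
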